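/- \textbf{Definitions.} A metric space $X$ is \emph{uniformly locally finite} (u.l.f.) if $\sup_{x\in X}|\{y\in X: d(x,y)\le r\}|<\infty$ for all $r>0$. It is \emph{sparse} if $X=\bigsqcup_{n\in\mathbb N}X_n$ with all $X_n$ finite and $d(X_n,X_m)\to\infty$ as $n+m\to\infty$, $n\neq m$ (with $d(\emptyset,\cdot)=\infty$). A map $f\colon X\to Y$ of metric spaces is \emph{coarse} if for every $s>0$ there is $r>0$ such that $d(x,y)<s$ implies $d(f(x),f(y))<r$; \emph{expanding} if for every $r>0$ there is $s>0$ such that $d(x,y)>s$ implies $d(f(x),f(y))>r$; and a \emph{coarse embedding} if it is both. We say that $X$ \emph{coarsely embeds} into $Y$ if there is a coarse embedding $X\to Y$. Let $H_X$ be an infinite-dimensional separable complex Hilbert space. For $a\in\mathcal B(\ell_2(X,H_X))$ and $x,y\in X$ let $a_{xy}\in\mathcal B(H_X)$ be the matrix entry $v\mapsto (a(\delta_x\otimes v))(y)$; $a$ has \emph{finite propagation} if $\sup\{d(x,y): a_{xy}\ne 0\}<\infty$. Over $H_X$, define the following sets as the norm closures of the sets of those finite propagation operators $a$ on $\ell_2(X,H_X)$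 for which, respectively: \begin{itemize} \item $\mathrm C^*(X)$ (the Roe algebra): all $a_{xy}$ are compact; \item $\mathrm{UC}^*(X)$ (the uniform algebra): there is $N\in\mathbb N$ with $\operatorname{rank}(a_{xy})\le N$ for all $x,y\in X$; \item $\mathrm C^*_s(X)$ (the stable Roe algebra): there is a finite-dimensional subspace $K\subset H_X$ with $a_{xy}\in\mathcal B(K)$ for all $x,y\in X$, where $\mathcal B(K)$ is the set of operators on $H_X$ that map into $K$ and vanish on $K^\perp$. \end{itemize} A \emph{Roe-like} $\mathrm C^*$-algebra over $X$ is a norm closed $*$-subalgebra $A$ of $\mathcal B(\ell_2(X,H_X))$ with $\mathrm C^*_s(X)\subset A\subset\mathrm C^*(X)$. An operator $a\in \mathrm C^*(X)$ is a \emph{ghost} if for every $\varepsilon>0$ there is a finite $F\subset X$ with $\|a_{xy}\|<\varepsilon$ for all $x,y\notin F$. We say that \emph{all sparse subspaces of $Y$ yield only compact ghost projections in their Roe algebras} if for every sparse subspace $Y'\subset Y$, every ghost (orthogonal) projection in $\mathrm C^*(Y')$ (over $H_Y$) is compact. A norm closed $*$-subalgebra $C$ of a $\mathrm C^*$-algebra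 $B$ is \emph{hereditary} if $0\le b\le c$ with $b\in B$ and $c\in C$ implies $b\in C$. \textbf{Theorem.} Let $X$ and $Y$ be u.l.f. metric spaces and let $H_X$ and $H_Y$ be infinite-dimensional separable complex Hilbert spaces. Assume that all sparse subspaces of $Y$ yield only compact ghost projections in their Roe algebras. Let $A\subset\mathrm C^*(X)$ and $B\subset\mathrm C^*(Y)$ be Roe-like $\mathrm C^*$-algebras (over $H_X$ and $H_Y$) such that either $B=\mathrm C^*_s(Y)$ or $\mathrm{UC}^*(Y)\subset B$. If there is an injective $*$-homomorphism $A\to B$ whose image is a hereditary $\mathrm C^*$-subalgebra of $B$, then $X$ coarsely embeds into $Y$. -/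

import Mathlib

open scoped ENNReal

noncomputable section

namespace RoeRigidity

/-! ### Coarse geometry -/

/-- `X` is uniformly locally finite: closed balls of radius `r` have uniformly bounded
cardinality, for every `r > 0`. -/
def UniformlyLocallyFinite (X : Type*) [MetricSpace X] : Prop :=
  ∀ r : ℝ, 0 < r → ∃ N : ℕ, ∀ x : X, {y : X | dist x y ≤ r}.encard ≤ N

/-- `X` is sparse: it is a disjoint union of finite sets `P n` such that the distance between
`P n` and `P m`, `n ≠ m`, tends to infinity as `n + m → ∞` (an empty piece is at infinite
distance from every set). -/
def IsSparse (X : Type*) [MetricSpace X] : Prop :=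
  ∃ P : ℕ → Set X,
    (⋃ n, P n) = Set.univ ∧
    Pairwise (fun n m => Disjoint (P n) (P m)) ∧
    (∀ n, (P n).Finite) ∧
    ∀ r : ℝ, ∃ N : ℕ, ∀ n m : ℕ, n ≠ m → N ≤ n + m → ∀ x ∈ P n, ∀ y ∈ P m, r ≤ dist x y

/-- Coarse maps. -/
def IsCoarse {X Y : Type*} [MetricSpace X] [MetricSpace Y] (f : X → Y) : Prop :=
  ∀ s : ℝ, 0 < s → ∃ r : ℝ, 0 < r ∧ ∀ x y : X, dist x y < s → dist (f x) (f y) < r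

/-- Expanding maps. -/
def IsExpanding {X Y : Type*} [MetricSpace X] [MetricSpace Y] (f : X → Y) : Prop :=
  ∀ r : ℝ, 0 < r → ∃ s : ℝ, 0 < s ∧ ∀ x y : X, s < dist x y → r < dist (f x) (f y)

/-- Coarse embeddings. -/
def IsCoarseEmbedding {X Y : Type*} [MetricSpace X] [MetricSpace Y] (f : X → Y) : Prop :=
  IsCoarse f ∧ IsExpanding f

/-! ### Roe algebras

`H` is the coefficient Hilbert space. -/

/-- The Hilbert space `ℓ₂(X, H)`: Mathlib's `lp (fun _ : X => H) 2`, with the same norm and inner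
product. (It is a separate type so that the operators on it carry a single additive structure.) -/
def L2 (X H : Type*) [NormedAddCommGroup H] : Type _ := lp (fun _ : X => H) 2

instance (X H : Type*) [NormedAddCommGroup H] : NormedAddCommGroup (L2 X H) :=
  inferInstanceAs (NormedAddCommGroup (lp (fun _ : X => H) 2))

instance (X H : Type*) [NormedAddCommGroup H] [InnerProductSpace ℂ H] :
    InnerProductSpace ℂ (L2 X H) :=
  inferInstanceAs (InnerProductSpace ℂ (lp (fun _ : X => H) 2))

instance (X H : Type*) [NormedAddCommGroup H] [CompleteSpace H] : CompleteSpace (L2 X H) :=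
  inferInstanceAs (CompleteSpace (lp (fun _ : X => H) 2))

/-- The identity `ℓ₂(X, H) = lp (fun _ : X => H) 2`, as a linear isometric equivalence. -/
def L2.toLp (X H : Type*) [NormedAddCommGroup H] [InnerProductSpace ℂ H] :
    L2 X H ≃ₗᵢ[ℂ] lp (fun _ : X => H) 2 where
  toFun f := f
  invFun f := f
  map_add' _ _ := rfl
  map_smul' _ _ := rfl
  left_inv _ := rfl
  right_inv _ := rfl
  norm_map' _ := rfl

open Classical in
/-- The isometric inclusion `v ↦ δ_x ⊗ v` of `H` into `ℓ₂(X, H)`. -/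
def L2.single {X H : Type*} [NormedAddCommGroup H] [InnerProductSpace ℂ H] (x : X) :
    H →L[ℂ] L2 X H :=
  ((L2.toLp X H).symm.toContinuousLinearEquiv : lp (fun _ : X => H) 2 →L[ℂ] L2 X H).comp
    (lp.singleContinuousLinearMap ℂ (fun _ : X => H) 2 x)

/-- The evaluation `f ↦ f y` of `ℓ₂(X, H)` at a point. -/
def L2.eval {X H : Type*} [NormedAddCommGroup H] [InnerProductSpace ℂ H] (y : X) :
    L2 X H →L[ℂ] H :=
  (lp.evalCLM ℂ (fun _ : X => H) 2 y).comp
    ((L2.toLp X H).toContinuousLinearEquiv : L2 X H →L[ℂ] lp (fun _ : X => H) 2)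

section Operators

variable {X H : Type*} [NormedAddCommGroup H] [InnerProductSpace ℂ H]

/-- The matrix entry `a_{xy}` of an operator on `ℓ₂(X, H)`, as an operator on `H`:
`v ↦ (a (δ_x ⊗ v)) y`. -/
def entry (a : L2 X H →L[ℂ] L2 X H) (x y : X) : H →L[ℂ] H :=
  (L2.eval y).comp (a.comp (L2.single x))

/-- The propagation `sup {d(x, y) | a_{xy} ≠ 0}` is finite. -/
def HasFinitePropagation [MetricSpace X] (a : L2 X H →L[ℂ] L2 X H) : Prop :=
  ∃ r : ℝ, ∀ x y : X, entry a x y ≠ 0 → dist x y ≤ r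

end Operators

section Algebras

variable (X H : Type*) [MetricSpace X] [NormedAddCommGroup H] [InnerProductSpace ℂ H]

/-- The Roe algebra `C*(X)` over `H`: the norm closure of the finite propagation operators with
compact entries. -/
def roeAlgebra : Set (L2 X H →L[ℂ] L2 X H) :=
  closure {a | HasFinitePropagation a ∧ ∀ x y : X, IsCompactOperator (entry a x y)}

/-- The uniform algebra `UC*(X)` over `H`: the norm closure of the finite propagation operators
whose entries have uniformly bounded finite rank. -/
def uniformAlgebra : Set (L2 X H →L[ℂ] L2 X H) :=
  closure {a | HasFinitePropagation a ∧
    ∃ N : ℕ, ∀ x y : X, LinearMap.rank (entry a x y : H →ₗ[ℂ] H) ≤ N}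

/-- The stable Roe algebra `C*_s(X)` over `H`: the norm closure of the finite propagation
operators whose entries all lie in `B(K)` for one finite-dimensional subspace `K` of `H`,
where `b ∈ B(H)` lies in `B(K)` if it maps into `K` and vanishes on the complement of `K`. -/
def stableRoeAlgebra : Set (L2 X H →L[ℂ] L2 X H) :=
  closure {a | HasFinitePropagation a ∧
    ∃ K : Submodule ℂ H, FiniteDimensional ℂ K ∧
      ∀ x y : X, (∀ v, entry a x y v ∈ K) ∧ ∀ v ∈ Kᗮ, entry a x y v = 0}

end Algebras

/-- Ghost operators: matrix entries become small outside of finite sets. -/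
def IsGhost {X H : Type*} [NormedAddCommGroup H] [InnerProductSpace ℂ H]
    (a : L2 X H →L[ℂ] L2 X H) : Prop :=
  ∀ ε : ℝ, 0 < ε → ∃ F : Finset X, ∀ x y : X, x ∉ F → y ∉ F → ‖entry a x y‖ < ε

/-- All sparse subspaces of `Y` yield only compact ghost projections in their Roe algebras
(over `H`). -/
def SparseSubspacesYieldCompactGhosts (Y H : Type*) [MetricSpace Y]
    [NormedAddCommGroup H] [InnerProductSpace ℂ H] [CompleteSpace H] : Prop :=
  ∀ S : Set Y, IsSparse S → ∀ p ∈ roeAlgebra S H,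
    IsStarProjection p → IsGhost p → IsCompactOperator p

/-- `A` is a Roe-like C*-algebra: a norm closed *-subalgebra with `C*_s(X) ⊆ A ⊆ C*(X)`. -/
structure IsRoeLike {X H : Type*} [MetricSpace X] [NormedAddCommGroup H]
    [InnerProductSpace ℂ H] [CompleteSpace H]
    (A : NonUnitalStarSubalgebra ℂ (L2 X H →L[ℂ] L2 X H)) : Prop where
  isClosed : IsClosed (A : Set (L2 X H →L[ℂ] L2 X H))
  stable_subset : stableRoeAlgebra X H ⊆ A
  subset_roe : (A : Set (L2 X H →L[ℂ] L2 X H)) ⊆ roeAlgebra X H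

/-- `C` is a hereditary C*-subalgebra of the C*-algebra `B` of operators on a Hilbert space `E`:
`C` is a norm closed *-subalgebra of `B`, and `0 ≤ b ≤ c` with `b ∈ B`, `c ∈ C` implies `b ∈ C`.
The order on `B` is the restriction of the order of positive operators on `E`. -/
structure IsHereditarySubalgebra {E : Type*} [NormedAddCommGroup E] [InnerProductSpace ℂ E]
    [CompleteSpace E] (C B : NonUnitalStarSubalgebra ℂ (E →L[ℂ] E)) : Prop where
  isClosed : IsClosed (C : Set (E →L[ℂ] E))
  le : C ≤ B
  hereditary : ∀ b ∈ B, ∀ c ∈ C, 0 ≤ b → b ≤ c → b ∈ C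

/-- `A` embeds onto a hereditary C*-subalgebra of `B`: there is an injective *-homomorphism
`A → B` whose range is a hereditary C*-subalgebra of `B`. -/
def EmbedsOntoHereditary {E F : Type*} [NormedAddCommGroup E] [InnerProductSpace ℂ E]
    [CompleteSpace E] [NormedAddCommGroup F] [InnerProductSpace ℂ F] [CompleteSpace F]
    (A : NonUnitalStarSubalgebra ℂ (E →L[ℂ] E))
    (B : NonUnitalStarSubalgebra ℂ (F →L[ℂ] F)) : Prop :=
  ∃ Φ : A →⋆ₙₐ[ℂ] B, Function.Injective Φ ∧
    ∃ C : NonUnitalStarSubalgebra ℂ (F →L[ℂ] F), IsHereditarySubalgebra C B ∧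
      Set.range (fun a : A => (Φ a : F →L[ℂ] F)) = C

end RoeRigidity

end

/-!
Fix a unit vector `v` of `HX` and put `ξ x = δ_x ⊗ v`. The rank one operators between the vectors
`ξ x` are matrix units in `A`, and heredity of the image of the embedding `Φ` makes the images of
these matrix units rank one operators between the vectors `η x` of an orthonormal family in
`ℓ₂(Y, HY)`. Heredity also identifies the image of a partial translation `∑ i, ξ (q i) ⊗ (ξ (p i))*`
with `∑ i, η (q i) ⊗ (η (p i))*`, and lets matrix coefficients be pulled back: for `b ∈ B` there
is `a ∈ A` with `⟨ξ x', a (ξ x)⟩ = ⟨η x', b (η x)⟩`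
(`EmbedsOntoHereditary.exists_orthonormal`).

The ghost hypothesis gives `δ > 0` such that every `η x` has a coordinate of norm at least `δ`
(`SparseSubspacesYieldCompactGhosts.exists_le_norm_eval`). Otherwise some sequence of vectors `η x`
could be perturbed summably to orthonormal vectors with finite supports drifting apart, whose
coordinates tend to zero. The projection onto their span differs by a norm convergent series of
finite rank operators from the image of a projection in `A`, so it lies in `B`, and it restricts to
a noncompact ghost projection on a sparse subspace of `Y`.

Let `f x` be a point where `η x` has norm at least `δ`. Since `C*(Y)` is locally compact, the
coordinates of `η x` at a fixed point vanish as `x → ∞`. Any sequence of pairs of points violating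
coarseness or expansion of `f` therefore has a subsequence along which the vectors `η x` hardly
interfere at the points `f x` (`exists_pairs_of_small_interference`). If `f` were not coarse, the
image of the corresponding partial translation of `X` would have large entries far from the
diagonal (`isCoarse_of_detecting`). If `f` were not expanding, a partial translation of `Y` with
suitable rank one coefficients would lie in `B` (this is where `B` is assumed to be stable or to
contain the uniform algebra) and would pull back to an element of `A` with large entries far from
the diagonal (`isExpanding_of_detecting`). Both contradict the decay of matrix entries of operators
in a Roe algebra (`exists_norm_entry_lt_of_mem_roeAlgebra`).
-/

noncomputable section

namespace RoeRigidity

open Filter Topology InnerProductSpace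

/-! ### Partial isometries between orthonormal families -/

section PartialIsometry

variable {E F G ι : Type*} [NormedAddCommGroup E] [InnerProductSpace ℂ E] [CompleteSpace E]
  [NormedAddCommGroup F] [InnerProductSpace ℂ F] [CompleteSpace F]
  [NormedAddCommGroup G] [InnerProductSpace ℂ G]

/-- The partial isometry `∑ i, β i ⊗ (α i)*` taking the orthonormal family `α` to the orthonormal
family `β` and vanishing on the orthogonal complement of `α`. The sum converges strongly; it is
encoded as the composition of the synthesis operator of `β` with the analysis operator of `α`. -/
def partialIsometry {α : ι → E} {β : ι → F} (hα : Orthonormal ℂ α) (hβ : Orthonormal ℂ β) :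
    E →L[ℂ] F :=
  hβ.orthogonalFamily.linearIsometry.toContinuousLinearMap ∘L
    ContinuousLinearMap.adjoint hα.orthogonalFamily.linearIsometry.toContinuousLinearMap

variable {α : ι → E} {β : ι → F} {γ : ι → G}

theorem hasSum_partialIsometry (hα : Orthonormal ℂ α) (hβ : Orthonormal ℂ β) (ζ : E) :
    HasSum (fun i => inner ℂ (α i) ζ • β i) (partialIsometry hα hβ ζ) := by
  classical
  have h := hβ.orthogonalFamily.hasSum_linearIsometry
    (ContinuousLinearMap.adjoint hα.orthogonalFamily.linearIsometry.toContinuousLinearMap ζ)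
  suffices hs : (fun i => inner ℂ (α i) ζ • β i) = _ from hs ▸ h
  funext i
  have h2 := lp.inner_single_left (𝕜 := ℂ) (G := fun _ : ι => ℂ) i (1 : ℂ)
    (ContinuousLinearMap.adjoint hα.orthogonalFamily.linearIsometry.toContinuousLinearMap ζ)
  rw [ContinuousLinearMap.adjoint_inner_right] at h2
  simp only [LinearIsometry.coe_toContinuousLinearMap,
    OrthogonalFamily.linearIsometry_apply_single] at h2
  simp at h2
  simp [h2]

theorem partialIsometry_apply_self (hα : Orthonormal ℂ α) (hβ : Orthonormal ℂ β) (i : ι) :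
    partialIsometry hα hβ (α i) = β i := by
  refine (hasSum_partialIsometry hα hβ (α i)).unique ?_
  convert hasSum_single i ?_ using 1
  · simp [inner_self_eq_norm_sq_to_K, hα.norm_eq_one]
  · intro j hj
    simp [hα.inner_eq_zero hj]

theorem partialIsometry_apply_eq_zero (hα : Orthonormal ℂ α) (hβ : Orthonormal ℂ β) {ζ : E}
    (hζ : ∀ i, inner ℂ (α i) ζ = 0) : partialIsometry hα hβ ζ = 0 := by
  refine (hasSum_partialIsometry hα hβ ζ).unique ?_
  simp [hζ]

/-- A bounded operator is determined on the closed span of an orthonormal family by its values on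
the family. -/
theorem comp_partialIsometry_congr (hα : Orthonormal ℂ α) (hβ : Orthonormal ℂ β) {S T : F →L[ℂ] G}
    (h : ∀ i, S (β i) = T (β i)) : S ∘L partialIsometry hα hβ = T ∘L partialIsometry hα hβ := by
  ext ζ
  have h1 := (hasSum_partialIsometry hα hβ ζ).mapL S
  have h2 := (hasSum_partialIsometry hα hβ ζ).mapL T
  simp only [map_smul, h] at h1 h2
  exact h1.unique h2

theorem comp_partialIsometry [CompleteSpace G] (hα : Orthonormal ℂ α) (hβ : Orthonormal ℂ β)
    (hγ : Orthonormal ℂ γ) {S : F →L[ℂ] G} (h : ∀ i, S (β i) = γ i) :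
    S ∘L partialIsometry hα hβ = partialIsometry hα hγ := by
  ext ζ
  have h1 := (hasSum_partialIsometry hα hβ ζ).mapL S
  simp only [map_smul, h] at h1
  exact h1.unique (hasSum_partialIsometry hα hγ ζ)

theorem hasSum_inner_partialIsometry (hα : Orthonormal ℂ α) (hβ : Orthonormal ℂ β) (ζ : E)
    (ω : F) :
    HasSum (fun i => inner ℂ (α i) ζ * inner ℂ ω (β i)) (inner ℂ ω (partialIsometry hα hβ ζ)) := by
  simpa using (hasSum_partialIsometry hα hβ ζ).mapL (innerSL ℂ ω)

theorem inner_partialIsometry_left (hα : Orthonormal ℂ α) (hβ : Orthonormal ℂ β) (i : ι) (ζ : E) :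
    inner ℂ (β i) (partialIsometry hα hβ ζ) = inner ℂ (α i) ζ := by
  refine (hasSum_inner_partialIsometry hα hβ ζ (β i)).unique ?_
  convert hasSum_single i ?_ using 1
  · simp [inner_self_eq_norm_sq_to_K, hβ.norm_eq_one]
  · intro j hj
    simp [hβ.inner_eq_zero hj.symm]

theorem adjoint_partialIsometry (hα : Orthonormal ℂ α) (hβ : Orthonormal ℂ β) :
    ContinuousLinearMap.adjoint (partialIsometry hα hβ) = partialIsometry hβ hα := by
  simp [partialIsometry, ContinuousLinearMap.adjoint_comp]

/-- The partial isometry starting from a subfamily of `α` absorbs the projection onto the closed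
span of `α`. -/
theorem partialIsometry_comp_partialIsometry_self {κ : Type*} (hα : Orthonormal ℂ α) {p : κ → ι}
    (hp : Function.Injective p) {β : κ → F} (hβ : Orthonormal ℂ β) :
    partialIsometry (hα.comp p hp) hβ ∘L partialIsometry hα hα =
      partialIsometry (hα.comp p hp) hβ := by
  ext1 ζ
  have h := hasSum_partialIsometry (hα.comp p hp) hβ (partialIsometry hα hα ζ)
  simp only [Function.comp_apply, inner_partialIsometry_left] at h
  exact h.unique (hasSum_partialIsometry (hα.comp p hp) hβ ζ)

/-- The projection onto the closed span of an orthonormal family. -/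
theorem isStarProjection_partialIsometry (hα : Orthonormal ℂ α) :
    IsStarProjection (partialIsometry hα hα) :=
  ⟨comp_partialIsometry hα hα hα (partialIsometry_apply_self hα hα),
    adjoint_partialIsometry hα hα⟩

/-- If one summand of the strong sum `⟨ω, T ζ⟩ = ∑ ⟨α k, ζ⟩ ⟨ω, β k⟩` is at least `c` and the
others are dominated by `ε / 2 ^ k`, then `⟨ω, T ζ⟩` is at least `c - 2 ε`. -/
theorem le_norm_inner_partialIsometry {α : ℕ → E} {β : ℕ → F} (hα : Orthonormal ℂ α)
    (hβ : Orthonormal ℂ β) {ζ : E} {ω : F} {c ε : ℝ} (hε : 0 ≤ ε) (n : ℕ)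
    (hn : c ≤ ‖inner ℂ (α n) ζ * inner ℂ ω (β n)‖)
    (hk : ∀ k, k ≠ n → ‖inner ℂ (α k) ζ * inner ℂ ω (β k)‖ ≤ ε * (1 / 2) ^ k) :
    c - 2 * ε ≤ ‖inner ℂ ω (partialIsometry hα hβ ζ)‖ := by
  have h := hasSum_inner_partialIsometry hα hβ ζ ω
  set s : ℕ → ℂ := fun i => inner ℂ (α i) ζ * inner ℂ ω (β i) with hs
  have h1 : HasSum (fun k => s k - (if k = n then s n else 0))
      (inner ℂ ω (partialIsometry hα hβ ζ) - s n) := h.sub (hasSum_ite_eq n (s n))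
  have h2 : HasSum (fun k : ℕ => ε * (1 / 2 : ℝ) ^ k) (ε * 2) := hasSum_geometric_two.mul_left ε
  have h3 : ‖inner ℂ ω (partialIsometry hα hβ ζ) - s n‖ ≤ ε * 2 := by
    rw [← h1.tsum_eq]
    refine tsum_of_norm_bounded h2 fun k => ?_
    by_cases hkn : k = n
    · subst hkn; simp; positivity
    · simpa [hkn, hs] using hk k hkn
  have h4 := norm_sub_norm_le (s n) (s n - inner ℂ ω (partialIsometry hα hβ ζ))
  rw [norm_sub_rev] at h3
  simp only [sub_sub_cancel] at h4
  change c ≤ ‖s n‖ at hn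
  linarith

/-- A compact operator sends an orthonormal family to a family tending to zero. -/
theorem finite_setOf_le_norm_of_isCompactOperator {T : E →L[ℂ] F} (hT : IsCompactOperator T)
    (hα : Orthonormal ℂ α) {ε : ℝ} (hε : 0 < ε) : {i | ε ≤ ‖T (α i)‖}.Finite := by
  by_contra hinf
  have hinf : {i | ε ≤ ‖T (α i)‖}.Infinite := hinf
  obtain ⟨K, hK, hTK⟩ := hT.image_closedBall_subset_compact 1
  have hmem : ∀ i, T (α i) ∈ K := fun i => hTK ⟨α i, by simp [hα.norm_eq_one], rfl⟩
  set e := hinf.natEmbedding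
  obtain ⟨z, -, φ, hφ, hz⟩ := hK.tendsto_subseq (fun n => hmem (e n))
  -- the limit `z` of a convergent subsequence is orthogonal to itself by Bessel's inequality
  have h1 : Tendsto (fun n => inner ℂ z (T (α (e (φ n))))) atTop (𝓝 (inner ℂ z z)) :=
    ((innerSL ℂ z).continuous.tendsto z).comp hz
  have hinj : Function.Injective (fun n => (e (φ n) : ι)) :=
    Subtype.val_injective.comp (e.injective.comp hφ.injective)
  have h2 : Tendsto (fun n => inner ℂ z (T (α (e (φ n))))) atTop (𝓝 0) := by
    have hs := ((hα.comp _ hinj).inner_products_summable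
      (ContinuousLinearMap.adjoint T z)).tendsto_atTop_zero
    have hs' := (Real.continuous_sqrt.tendsto 0).comp hs
    rw [Real.sqrt_zero] at hs'
    rw [tendsto_zero_iff_norm_tendsto_zero]
    refine hs'.congr fun n => ?_
    simp only [Function.comp_apply, Real.sqrt_sq (norm_nonneg _)]
    rw [ContinuousLinearMap.adjoint_inner_right, norm_inner_symm]
  have h0 : z = 0 := inner_self_eq_zero.mp (tendsto_nhds_unique h1 h2)
  have h3 : ε ≤ ‖z‖ := ge_of_tendsto hz.norm (Eventually.of_forall fun n => (e (φ n)).2)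
  rw [h0, norm_zero] at h3
  exact absurd h3 (not_le.mpr hε)

omit [CompleteSpace E] in
theorem tendsto_rankOne {l : Filter ι} {f g : ι → E} {a b : E} (hf : Tendsto f l (𝓝 a))
    (hg : Tendsto g l (𝓝 b)) :
    Tendsto (fun i => rankOne ℂ (f i) (g i)) l (𝓝 (rankOne ℂ a b)) := by
  rw [tendsto_iff_norm_sub_tendsto_zero] at hf hg ⊢
  have hb : ∀ i, ‖rankOne ℂ (f i) (g i) - rankOne ℂ a b‖ ≤
      ‖f i - a‖ * (‖g i - b‖ + ‖b‖) + ‖a‖ * ‖g i - b‖ := by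
    intro i
    have h : rankOne ℂ (f i) (g i) - rankOne ℂ a b =
        rankOne ℂ (f i - a) (g i) + rankOne ℂ a (g i - b) := by
      simp [map_sub]
    rw [h]
    refine (norm_add_le _ _).trans ?_
    rw [norm_rankOne, norm_rankOne]
    gcongr
    simpa using norm_add_le (g i - b) b
  refine squeeze_zero (fun _ => norm_nonneg _) hb ?_
  simpa using (hf.mul (hg.add_const ‖b‖)).add (hg.const_mul ‖a‖)

/-- If `α` and `β` are summably close, then the projections onto their closed spans differ by a
norm convergent series of operators of rank at most two. -/
theorem hasSum_rankOne_sub_rankOne {α β : ℕ → E} (hα : Orthonormal ℂ α) (hβ : Orthonormal ℂ β)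
    (h : Summable fun n => ‖α n - β n‖) :
    HasSum (fun n => rankOne ℂ (α n) (α n) - rankOne ℂ (β n) (β n))
      (partialIsometry hα hα - partialIsometry hβ hβ) := by
  have hb : ∀ n, ‖rankOne ℂ (α n) (α n) - rankOne ℂ (β n) (β n)‖ ≤ 2 * ‖α n - β n‖ := by
    intro n
    have : rankOne ℂ (α n) (α n) - rankOne ℂ (β n) (β n) =
        rankOne ℂ (α n - β n) (α n) + rankOne ℂ (β n) (α n - β n) := by
      simp [map_sub]
    rw [this]
    refine (norm_add_le _ _).trans ?_
    rw [norm_rankOne, norm_rankOne, hα.norm_eq_one, hβ.norm_eq_one, mul_one, one_mul, two_mul]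
  have hs : Summable fun n => rankOne ℂ (α n) (α n) - rankOne ℂ (β n) (β n) :=
    Summable.of_norm_bounded (h.mul_left 2) hb
  convert hs.hasSum
  ext ζ
  have h1 := hs.hasSum.mapL (ContinuousLinearMap.apply ℂ E ζ)
  have h2 := (hasSum_partialIsometry hα hα ζ).sub (hasSum_partialIsometry hβ hβ ζ)
  exact h2.unique (by simpa using h1)

end PartialIsometry

/-! ### Vectors and matrix entries in `ℓ₂(X, H)` -/

section L2

variable {X H : Type*} [NormedAddCommGroup H] [InnerProductSpace ℂ H]

open Classical in
@[simp]
theorem L2.eval_single_self (x : X) (v : H) : L2.eval x (L2.single x v) = v :=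
  lp.single_apply_self (E := fun _ : X => H) 2 x v

open Classical in
theorem L2.eval_single_of_ne {x y : X} (h : y ≠ x) (v : H) : L2.eval y (L2.single x v) = 0 :=
  lp.single_apply_ne (E := fun _ : X => H) 2 x v h

open Classical in
@[simp]
theorem L2.norm_single (x : X) (v : H) : ‖L2.single x v‖ = ‖v‖ :=
  lp.norm_single (E := fun _ : X => H) (p := 2) (by norm_num) x v

theorem L2.norm_eval_le (x : X) (f : L2 X H) : ‖L2.eval x f‖ ≤ ‖f‖ :=
  lp.norm_apply_le_norm (E := fun _ : X => H) (by norm_num) f x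

open Classical in
theorem L2.hasSum_single (f : L2 X H) : HasSum (fun x => L2.single x (L2.eval x f)) f :=
  lp.hasSum_single (E := fun _ : X => H) (p := 2) (by norm_num) f

open Classical in
@[simp]
theorem L2.inner_single_left (x : X) (v : H) (f : L2 X H) :
    inner ℂ (L2.single x v) f = inner ℂ v (L2.eval x f) :=
  lp.inner_single_left (𝕜 := ℂ) (G := fun _ : X => H) x v f

@[simp]
theorem L2.inner_single_right (x : X) (v : H) (f : L2 X H) :
    inner ℂ f (L2.single x v) = inner ℂ (L2.eval x f) v := by
  rw [← inner_conj_symm, L2.inner_single_left, inner_conj_symm]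

theorem L2.eval_sum_single [DecidableEq X] (S : Finset X) (f : L2 X H) (y : X) :
    L2.eval y (∑ x ∈ S, L2.single x (L2.eval x f)) = if y ∈ S then L2.eval y f else 0 := by
  rw [map_sum]
  split_ifs with hy
  · rw [Finset.sum_eq_single_of_mem y hy fun x _ hx => L2.eval_single_of_ne hx.symm _]
    simp
  · exact Finset.sum_eq_zero fun x hx =>
      L2.eval_single_of_ne (fun h : y = x => hy (h.symm ▸ hx)) _

theorem entry_apply (a : L2 X H →L[ℂ] L2 X H) (x y : X) (v : H) :
    entry a x y v = L2.eval y (a (L2.single x v)) := rfl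

theorem norm_entry_le (a : L2 X H →L[ℂ] L2 X H) (x y : X) : ‖entry a x y‖ ≤ ‖a‖ := by
  refine ContinuousLinearMap.opNorm_le_bound _ (norm_nonneg _) fun v => ?_
  calc ‖entry a x y v‖ ≤ ‖a (L2.single x v)‖ := L2.norm_eval_le _ _
    _ ≤ ‖a‖ * ‖v‖ := by simpa using a.le_opNorm (L2.single x v)

theorem entry_sub (a b : L2 X H →L[ℂ] L2 X H) (x y : X) :
    entry (a - b) x y = entry a x y - entry b x y := by
  ext v; simp [entry_apply]

theorem norm_inner_single_le (a : L2 X H →L[ℂ] L2 X H) (x y : X) (v w : H) :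
    ‖inner ℂ (L2.single y w) (a (L2.single x v))‖ ≤ ‖w‖ * (‖entry a x y‖ * ‖v‖) := by
  rw [L2.inner_single_left]
  exact (norm_inner_le_norm _ _).trans
    (mul_le_mul_of_nonneg_left ((entry a x y).le_opNorm v) (norm_nonneg _))

theorem orthonormal_single {ι : Type*} {p : ι → X} (hp : Function.Injective p) {u : ι → H}
    (hu : ∀ i, ‖u i‖ = 1) : Orthonormal ℂ fun i => L2.single (p i) (u i) := by
  refine ⟨fun i => by simp [hu], fun i j hij => ?_⟩
  simp [L2.eval_single_of_ne (hp.ne hij.symm)]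

variable [CompleteSpace H]

theorem hasSum_entry_partialIsometry {ι : Type*} {α β : ι → L2 X H} (hα : Orthonormal ℂ α)
    (hβ : Orthonormal ℂ β) (x y : X) (v : H) :
    HasSum (fun i => inner ℂ (L2.eval x (α i)) v • L2.eval y (β i))
      (entry (partialIsometry hα hβ) x y v) := by
  simpa [entry_apply] using (hasSum_partialIsometry hα hβ (L2.single x v)).mapL (L2.eval y)

section Single

variable {ι : Type*} {p q : ι → X} {u w : ι → H}
  (hα : Orthonormal ℂ fun i => L2.single (p i) (u i))
  (hβ : Orthonormal ℂ fun i => L2.single (q i) (w i))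

include hα hβ

/-- The entries of a partial isometry matching the points `p i` with the points `q i`. -/
theorem entry_partialIsometry_single (hp : Function.Injective p) (x y : X) :
    entry (partialIsometry hα hβ) x y = 0 ∨
      ∃ i, p i = x ∧ q i = y ∧ entry (partialIsometry hα hβ) x y = rankOne ℂ (w i) (u i) := by
  by_cases h : ∃ i, p i = x ∧ q i = y
  · obtain ⟨i, rfl, rfl⟩ := h
    refine Or.inr ⟨i, rfl, rfl, ?_⟩
    ext v
    refine (hasSum_entry_partialIsometry hα hβ _ _ v).unique ?_
    convert _root_.hasSum_single i ?_ using 1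
    · simp
    · intro j hj
      rw [L2.eval_single_of_ne (hp.ne hj.symm)]
      simp
  · left
    ext v
    refine (hasSum_entry_partialIsometry hα hβ _ _ v).unique ?_
    suffices hs : ∀ i, inner ℂ (L2.eval x (L2.single (p i) (u i))) v •
        L2.eval y (L2.single (q i) (w i)) = 0 by
      simp [hs]
    intro i
    by_cases hx : x = p i
    · rw [L2.eval_single_of_ne (x := q i) (y := y) fun hy => h ⟨i, hx.symm, hy.symm⟩, smul_zero]
    · rw [L2.eval_single_of_ne hx]; simp

theorem hasFinitePropagation_partialIsometry_single [MetricSpace X] (hp : Function.Injective p)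
    {r : ℝ} (hr : ∀ i, dist (p i) (q i) ≤ r) : HasFinitePropagation (partialIsometry hα hβ) := by
  refine ⟨r, fun x y hxy => ?_⟩
  obtain h | ⟨i, rfl, rfl, -⟩ := entry_partialIsometry_single hα hβ hp x y
  · exact absurd h hxy
  · exact hr i

theorem partialIsometry_single_mem_uniformAlgebra [MetricSpace X] (hp : Function.Injective p)
    {r : ℝ} (hr : ∀ i, dist (p i) (q i) ≤ r) : partialIsometry hα hβ ∈ uniformAlgebra X H := by
  refine subset_closure ⟨hasFinitePropagation_partialIsometry_single hα hβ hp hr, 1, fun x y => ?_⟩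
  obtain h | ⟨i, rfl, rfl, h⟩ := entry_partialIsometry_single hα hβ hp x y
  · rw [h]; simp
  · rw [h, LinearMap.rank, toLinearMap_rankOne]
    refine (Submodule.rank_mono (t := Submodule.span ℂ {w i}) ?_).trans ?_
    · rintro _ ⟨v, rfl⟩
      exact Submodule.mem_span_singleton.mpr ⟨inner ℂ (u i) v, by simp⟩
    · simpa using rank_span_le (R := ℂ) {w i}

theorem partialIsometry_single_mem_stableRoeAlgebra [MetricSpace X] (hp : Function.Injective p)
    {r : ℝ} (hr : ∀ i, dist (p i) (q i) ≤ r) {K : Submodule ℂ H} (hK : FiniteDimensional ℂ K)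
    (hu : ∀ i, u i ∈ K) (hw : ∀ i, w i ∈ K) : partialIsometry hα hβ ∈ stableRoeAlgebra X H := by
  refine subset_closure
    ⟨hasFinitePropagation_partialIsometry_single hα hβ hp hr, K, hK, fun x y => ?_⟩
  obtain h | ⟨i, rfl, rfl, h⟩ := entry_partialIsometry_single hα hβ hp x y
  · simp [h]
  · rw [h]
    refine ⟨fun v => ?_, fun v hv => ?_⟩
    · simpa using K.smul_mem _ (hw i)
    · simp [Submodule.inner_right_of_mem_orthogonal (hu i) hv]

end Single

omit [CompleteSpace H] in
/-- Operators of rank one are norm limits of operators of rank one between finitely supported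
vectors, so they belong to the stable Roe algebra. -/
theorem rankOne_mem_stableRoeAlgebra [MetricSpace X] (ζ ω : L2 X H) :
    rankOne ℂ ζ ω ∈ stableRoeAlgebra X H := by
  classical
  have h1 : Tendsto (fun s : Finset X => rankOne ℂ (∑ x ∈ s, L2.single x (L2.eval x ζ))
      (∑ x ∈ s, L2.single x (L2.eval x ω))) atTop (𝓝 (rankOne ℂ ζ ω)) := by
    have hs : ∀ f : L2 X H, Tendsto (fun s : Finset X => ∑ x ∈ s, L2.single x (L2.eval x f)) atTop
        (𝓝 f) := fun f => by
      have h := L2.hasSum_single f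
      rwa [HasSum, SummationFilter.unconditional_filter] at h
    exact tendsto_rankOne (hs ζ) (hs ω)
  refine isClosed_closure.mem_of_tendsto h1 (Eventually.of_forall fun s => subset_closure ?_)
  have hent : ∀ x y v, entry (rankOne ℂ (∑ x ∈ s, L2.single x (L2.eval x ζ))
      (∑ x ∈ s, L2.single x (L2.eval x ω))) x y v =
      inner ℂ (if x ∈ s then L2.eval x ω else 0) v • (if y ∈ s then L2.eval y ζ else 0) := by
    intro x y v
    rw [entry_apply, rankOne_apply, map_smul, L2.eval_sum_single, L2.inner_single_right,
      L2.eval_sum_single]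
  constructor
  · obtain ⟨r, hr⟩ := ((s ×ˢ s).image fun q : X × X => dist q.1 q.2).bddAbove
    refine ⟨r, fun x y hxy => hr ?_⟩
    have hx : x ∈ s := by
      by_contra hx; exact hxy (by ext v; rw [hent, if_neg hx]; simp)
    have hy : y ∈ s := by
      by_contra hy; exact hxy (by ext v; rw [hent, if_neg hy]; simp)
    simp only [Finset.coe_image, Set.mem_image, Finset.mem_coe, Finset.mem_product]
    exact ⟨(x, y), ⟨hx, hy⟩, rfl⟩
  · refine ⟨Submodule.span ℂ ((s.image fun x => L2.eval x ζ) ∪ (s.image fun x => L2.eval x ω) :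
      Finset H), inferInstance, fun x y => ⟨fun v => ?_, fun v hv => ?_⟩⟩
    · rw [hent]
      refine Submodule.smul_mem _ _ ?_
      split_ifs with hy
      · refine Submodule.subset_span ?_
        simp only [Finset.coe_union, Finset.coe_image, Set.mem_union, Set.mem_image,
          Finset.mem_coe]
        exact Or.inl ⟨y, hy, rfl⟩
      · exact Submodule.zero_mem _
    · rw [hent]
      split_ifs with hx
      · rw [Submodule.inner_right_of_mem_orthogonal (Submodule.subset_span ?_) hv, zero_smul]
        simp only [Finset.coe_union, Finset.coe_image, Set.mem_union, Set.mem_image,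
          Finset.mem_coe]
        exact Or.inr ⟨x, hx, rfl⟩
      all_goals simp

end L2

/-! ### Operators in the Roe algebra -/

section Roe

variable {X H : Type*} [MetricSpace X] [NormedAddCommGroup H] [InnerProductSpace ℂ H]

/-- The entries of an operator in the Roe algebra vanish at infinity away from the diagonal. -/
theorem exists_norm_entry_lt_of_mem_roeAlgebra {a : L2 X H →L[ℂ] L2 X H}
    (ha : a ∈ roeAlgebra X H) {ε : ℝ} (hε : 0 < ε) :
    ∃ r, ∀ x y, r < dist x y → ‖entry a x y‖ < ε := by
  obtain ⟨t, ⟨⟨r, hr⟩, -⟩, hat⟩ := Metric.mem_closure_iff.mp ha ε hε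
  refine ⟨r, fun x y hxy => ?_⟩
  have h0 : entry t x y = 0 := by
    by_contra h
    exact absurd (hr x y h) (not_le.mpr hxy)
  calc ‖entry a x y‖ = ‖entry (a - t) x y‖ := by rw [entry_sub, h0, sub_zero]
    _ ≤ ‖a - t‖ := norm_entry_le _ _ _
    _ < ε := by rwa [← dist_eq_norm]

theorem UniformlyLocallyFinite.finite_closedBall (hX : UniformlyLocallyFinite X) (x : X) (r : ℝ) :
    {y | dist x y ≤ r}.Finite := by
  obtain ⟨N, hN⟩ := hX (max r 1) (by positivity)
  refine (Set.finite_of_encard_le_coe (hN x)).subset fun y hy =>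
    show dist x y ≤ _ from le_trans hy (le_max_left _ _)

variable [CompleteSpace H]

/-- Operators in the Roe algebra are locally compact: their rows are compact. -/
theorem isCompactOperator_eval_comp (hX : UniformlyLocallyFinite X) {a : L2 X H →L[ℂ] L2 X H}
    (ha : a ∈ roeAlgebra X H) (y : X) : IsCompactOperator ((L2.eval y).comp a) := by
  have hcl : IsClosed {a : L2 X H →L[ℂ] L2 X H | IsCompactOperator ((L2.eval y).comp a)} := by
    have := isClosed_setOfPred_isCompactOperator (σ₁₂ := RingHom.id ℂ) (M₁ := L2 X H) (M₂ := H)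
    exact this.preimage
      (f := fun a : L2 X H →L[ℂ] L2 X H => (L2.eval y).comp a) (by fun_prop)
  refine closure_minimal ?_ hcl ha
  rintro t ⟨⟨r, hr⟩, ht⟩
  have hfin := hX.finite_closedBall y r
  have heq : (L2.eval y).comp t = ∑ x ∈ hfin.toFinset, (entry t x y).comp (L2.eval x) := by
    ext f
    have h1 := (L2.hasSum_single f).mapL ((L2.eval y).comp t)
    refine h1.unique ?_
    rw [sum_apply]
    refine hasSum_sum_of_ne_finset_zero fun x hx => ?_
    have : entry t x y = 0 := by
      by_contra h
      exact hx (by simpa [dist_comm] using hr x y h)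
    exact congrArg (fun T : H →L[ℂ] H => T (L2.eval x f)) this
  change IsCompactOperator _
  rw [heq]
  rw [FunLike.coe_sum]
  exact Finset.sum_induction _ IsCompactOperator (fun _ _ => IsCompactOperator.add)
    isCompactOperator_zero fun x _ => (ht x y).comp_clm (L2.eval x)

end Roe

/-! ### Hereditary subalgebras -/

section Hereditary

variable {E : Type*} [NormedAddCommGroup E] [InnerProductSpace ℂ E] [CompleteSpace E]
  {C B : NonUnitalStarSubalgebra ℂ (E →L[ℂ] E)}

/-- A hereditary subalgebra `C` of `B` satisfies `c * b * star c ∈ C` for self-adjoint `b ∈ B`: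
the element `c * b * star c + ‖b‖ • (c * star c)` lies between `0` and
`2 * ‖b‖ • (c * star c)`. -/
theorem IsHereditarySubalgebra.mul_mul_star_mem (h : IsHereditarySubalgebra C B)
    {b c : E →L[ℂ] E} (hb : b ∈ B) (hsa : IsSelfAdjoint b) (hc : c ∈ C) : c * b * star c ∈ C := by
  have hcc : c * star c ∈ C := mul_mem hc (star_mem hc)
  have h1 : c * (algebraMap ℝ (E →L[ℂ] E) ‖b‖) * star c = (‖b‖ : ℂ) • (c * star c) := by
    rw [Algebra.algebraMap_eq_smul_one]
    simp
  have hle : c * b * star c ≤ (‖b‖ : ℂ) • (c * star c) := by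
    rw [← h1]; exact star_right_conjugate_le_conjugate hsa.le_algebraMap_norm_self c
  have hge : -((‖b‖ : ℂ) • (c * star c)) ≤ c * b * star c := by
    rw [← h1, ← neg_mul, ← mul_neg]
    exact star_right_conjugate_le_conjugate hsa.neg_algebraMap_norm_le_self c
  have hmem : c * b * star c + (‖b‖ : ℂ) • (c * star c) ∈ C := by
    refine h.hereditary _ ?_ ((2 * ‖b‖ : ℂ) • (c * star c)) (SMulMemClass.smul_mem _ hcc) ?_ ?_
    · exact add_mem (mul_mem (mul_mem (h.le hc) hb) (star_mem (h.le hc)))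
        (SMulMemClass.smul_mem _ (h.le hcc))
    · rwa [← neg_le_iff_add_nonneg]
    · rw [two_mul, add_smul]
      gcongr
  simpa using sub_mem hmem (SMulMemClass.smul_mem (‖b‖ : ℂ) hcc)

/-- A hereditary subalgebra `C` of `B` satisfies `C * B * C ⊆ C`, by polarization. -/
theorem IsHereditarySubalgebra.mul_mul_mem (h : IsHereditarySubalgebra C B)
    {b c d : E →L[ℂ] E} (hb : b ∈ B) (hc : c ∈ C) (hd : d ∈ C) : c * b * d ∈ C := by
  have key : ∀ b ∈ B, IsSelfAdjoint b → c * b * d ∈ C := by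
    intro b hb hsa
    have hm : ∀ z : ℂ, (c + z • star d) * b * star (c + z • star d) ∈ C := fun z =>
      h.mul_mul_star_mem hb hsa (add_mem hc (SMulMemClass.smul_mem z (star_mem hd)))
    have : c * b * d = (1 / 4 : ℂ) • ((c + (1 : ℂ) • star d) * b * star (c + (1 : ℂ) • star d)
        - (c + (-1 : ℂ) • star d) * b * star (c + (-1 : ℂ) • star d)
        + Complex.I • ((c + Complex.I • star d) * b * star (c + Complex.I • star d))
        - Complex.I • ((c + (-Complex.I) • star d) * b * star (c + (-Complex.I) • star d))) := by
      simp only [star_add, star_smul, star_star, add_mul, mul_add, smul_mul_assoc, mul_smul_comm,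
        smul_add, smul_sub, smul_smul, RCLike.star_def, map_neg, Complex.conj_I, map_one]
      match_scalars <;> ring_nf <;> simp [Complex.I_sq] <;> norm_num
    rw [this]
    exact SMulMemClass.smul_mem _ (sub_mem
      (add_mem (sub_mem (hm _) (hm _)) (SMulMemClass.smul_mem _ (hm _)))
      (SMulMemClass.smul_mem _ (hm _)))
  rw [← realPart_add_I_smul_imaginaryPart b, mul_add, add_mul, mul_smul_comm, smul_mul_assoc]
  have hre : (realPart b : E →L[ℂ] E) ∈ B := by
    rw [realPart_apply_coe, ← Complex.coe_smul]
    exact SMulMemClass.smul_mem _ (add_mem hb (star_mem hb))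
  have him : (imaginaryPart b : E →L[ℂ] E) ∈ B := by
    rw [imaginaryPart_apply_coe, ← Complex.coe_smul (2 : ℝ)⁻¹]
    exact SMulMemClass.smul_mem _ (SMulMemClass.smul_mem _ (sub_mem hb (star_mem hb)))
  exact add_mem (key _ hre (realPart b).2) (SMulMemClass.smul_mem _ (key _ him (imaginaryPart b).2))

end Hereditary

/-! ### Transport of matrix units -/

section Transport

variable {X Y HX HY : Type*} [MetricSpace X] [MetricSpace Y]
  [NormedAddCommGroup HX] [InnerProductSpace ℂ HX] [CompleteSpace HX]
  [NormedAddCommGroup HY] [InnerProductSpace ℂ HY] [CompleteSpace HY]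
  {A : NonUnitalStarSubalgebra ℂ (L2 X HX →L[ℂ] L2 X HX)}
  {B : NonUnitalStarSubalgebra ℂ (L2 Y HY →L[ℂ] L2 Y HY)}

set_option maxHeartbeats 1000000 in
/-- An embedding `Φ` of `A` onto a hereditary subalgebra of `B` carries the vectors `δ_x ⊗ v` to
an orthonormal family `η` which implements `Φ` on partial translations and, by heredity, allows
matrix coefficients to be pulled back from `B` to `A`. -/
theorem EmbedsOntoHereditary.exists_orthonormal (hA : stableRoeAlgebra X HX ⊆ A)
    (hB : stableRoeAlgebra Y HY ⊆ B) (hemb : EmbedsOntoHereditary A B) {v : HX} (hv : ‖v‖ = 1) :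
    ∃ (η : X → L2 Y HY) (hη : Orthonormal ℂ η),
      partialIsometry hη hη ∈ B ∧
      (∀ (p q : ℕ → X) (hp : Function.Injective p) (hq : Function.Injective q) (r : ℝ),
        (∀ i, dist (p i) (q i) ≤ r) →
          partialIsometry (hη.comp p hp) (hη.comp q hq) ∈ B) ∧
      ∀ b ∈ B, ∃ a ∈ A, ∀ x x' : X,
        inner ℂ (L2.single x' v) (a (L2.single x v)) = inner ℂ (η x') (b (η x)) := by
  obtain ⟨Φ, hΦ, C, hC, hrange⟩ := hemb
  obtain hX | ⟨⟨x₀⟩⟩ := isEmpty_or_nonempty X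
  · refine ⟨fun x => isEmptyElim x, Orthonormal.of_isEmpty _, ?_, fun p => isEmptyElim (p 0),
      fun b _ => ⟨0, zero_mem _, fun x => isEmptyElim x⟩⟩
    convert zero_mem B
    ext1 ζ
    exact partialIsometry_apply_eq_zero _ _ fun i => isEmptyElim i
  -- the composition of `Φ` with the inclusion of `B`
  let Ψ : A →⋆ₙₐ[ℂ] (L2 Y HY →L[ℂ] L2 Y HY) := (NonUnitalStarSubalgebraClass.subtype B).comp Φ
  have hΨ : Function.Injective Ψ := Subtype.val_injective.comp hΦ
  have hΨB : ∀ a, Ψ a ∈ B := fun a => (Φ a).2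
  have hΨC : ∀ a, Ψ a ∈ C := fun a => by
    have : Ψ a ∈ Set.range fun a : A => (Φ a : L2 Y HY →L[ℂ] L2 Y HY) := ⟨a, rfl⟩
    rwa [hrange] at this
  have hCΨ : ∀ c ∈ C, ∃ a, Ψ a = c := fun c hc => by
    have : c ∈ (C : Set (L2 Y HY →L[ℂ] L2 Y HY)) := hc
    rwa [← hrange] at this
  -- the orthonormal family `ξ`, its matrix units and the projection onto its span
  let ξ : X → L2 X HX := fun x => L2.single x v
  have hξ : Orthonormal ℂ ξ := orthonormal_single Function.injective_id fun _ => hv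
  let E : X → X → A := fun x y => ⟨rankOne ℂ (ξ y) (ξ x), hA (rankOne_mem_stableRoeAlgebra _ _)⟩
  let e : A := ⟨partialIsometry hξ hξ, hA <|
    partialIsometry_single_mem_stableRoeAlgebra hξ hξ Function.injective_id (r := 0) (by simp)
      (K := Submodule.span ℂ {v}) inferInstance (fun _ => Submodule.mem_span_singleton_self v)
      fun _ => Submodule.mem_span_singleton_self v⟩
  have hEaE : ∀ (w x y z : X) (a : A), E y z * a * E w x =
      (inner ℂ (ξ y) ((a : L2 X HX →L[ℂ] L2 X HX) (ξ x)) : ℂ) • E w z := by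
    intro w x y z a
    refine Subtype.ext (ContinuousLinearMap.ext fun ζ => ?_)
    simp [E, smul_smul, mul_comm]
  have hEE : ∀ x y z : X, E y z * E x y = E x z := by
    intro x y z
    refine Subtype.ext (ContinuousLinearMap.ext fun ζ => ?_)
    simp [E, inner_self_eq_norm_sq_to_K, hξ.norm_eq_one]
  have hEstar : ∀ x y : X, star (E x y) = E y x := fun x y =>
    Subtype.ext (adjoint_rankOne _ _)
  have hee : e * e = e := Subtype.ext (isStarProjection_partialIsometry hξ).isIdempotentElem
  have hestar : star e = e := Subtype.ext (isStarProjection_partialIsometry hξ).isSelfAdjoint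
  have heE : ∀ x y : X, e * E x y = E x y := by
    intro x y
    refine Subtype.ext (ContinuousLinearMap.ext fun ζ => ?_)
    simp [E, e, partialIsometry_apply_self]
  have hadj : ∀ a ζ ω, inner ℂ (Ψ a ζ) ω = inner ℂ ζ (Ψ (star a) ω) := by
    intro a ζ ω
    rw [map_star, ContinuousLinearMap.star_eq_adjoint, ContinuousLinearMap.adjoint_inner_right]
  have happ : ∀ a b ζ, Ψ a (Ψ b ζ) = Ψ (a * b) ζ := by
    intro a b ζ
    rw [map_mul, mul_apply_eq_comp]
  -- a unit vector `η₀` spanning the range of the image of the minimal projection `E x₀ x₀`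
  obtain ⟨η₀, hη₀, hfix⟩ : ∃ η₀, ‖η₀‖ = 1 ∧ Ψ (E x₀ x₀) η₀ = η₀ := by
    have hne : Ψ (E x₀ x₀) ≠ 0 := by
      rw [Ne, map_eq_zero_iff Ψ hΨ]
      intro h
      have h2 : rankOne ℂ (ξ x₀) (ξ x₀) = 0 := congrArg Subtype.val h
      rw [rankOne_eq_zero, or_self] at h2
      exact hξ.ne_zero x₀ h2
    obtain ⟨ζ, hζ⟩ : ∃ ζ, Ψ (E x₀ x₀) ζ ≠ 0 := by
      by_contra! h
      exact hne (ContinuousLinearMap.ext h)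
    refine ⟨(‖Ψ (E x₀ x₀) ζ‖⁻¹ : ℂ) • Ψ (E x₀ x₀) ζ, ?_, ?_⟩
    · simp [norm_smul, hζ]
    · rw [map_smul, happ, hEE]
  have hrank : ∀ ζ, Ψ (E x₀ x₀) ζ = (inner ℂ η₀ ζ : ℂ) • η₀ := by
    intro ζ
    -- heredity puts the compression of a rank one operator to the range of `Ψ (E x₀ x₀)` into
    -- the range of `Ψ`, where the compression by `E x₀ x₀` is scalar
    obtain ⟨a, ha⟩ := hCΨ _ (hC.mul_mul_mem (hB (rankOne_mem_stableRoeAlgebra ζ η₀))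
      (hΨC (E x₀ x₀)) (hΨC (E x₀ x₀)))
    have h1 : Ψ (E x₀ x₀ * a * E x₀ x₀) η₀ = Ψ (E x₀ x₀) ζ := by
      rw [map_mul, map_mul, ha]
      simp only [mul_apply_eq_comp, hfix, rankOne_apply, map_smul, happ, hEE]
      simp [inner_self_eq_norm_sq_to_K, hη₀]
    rw [hEaE, map_smul, smul_apply, hfix] at h1
    have h2 : inner ℂ η₀ (Ψ (E x₀ x₀) ζ) = inner ℂ η₀ ζ := by
      rw [← hEstar x₀ x₀, ← hadj, hfix]
    rw [← h1, inner_smul_right, inner_self_eq_norm_sq_to_K, hη₀] at h2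
    rw [← h1, ← h2]
    simp
  let η : X → L2 Y HY := fun x => Ψ (E x₀ x) η₀
  have hEη : ∀ x y ζ, Ψ (E x y) ζ = (inner ℂ (η x) ζ : ℂ) • η y := by
    intro x y ζ
    rw [← hEE x x₀ y, ← happ, ← hEE x₀ x₀ y, ← happ, hrank, map_smul, hadj, hEstar]
  have hη : Orthonormal ℂ η := by
    refine ⟨fun x => ?_, fun x y hxy => ?_⟩
    · rw [← sq_eq_sq₀ (norm_nonneg _) zero_le_one, ← Complex.ofReal_inj, Complex.ofReal_pow]
      have := inner_self_eq_norm_sq_to_K (𝕜 := ℂ) (η x)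
      rw [hadj, hEstar, happ, hEE, hfix, inner_self_eq_norm_sq_to_K, hη₀] at this
      simpa using this.symm
    · have h0 : E y x₀ * E x₀ x = 0 := by
        refine Subtype.ext (ContinuousLinearMap.ext fun ζ => ?_)
        simp [E, -L2.inner_single_left, -L2.inner_single_right, hξ.inner_eq_zero hxy.symm]
      have h1 : inner ℂ (η y) (η x) = 0 := by
        rw [hadj, hEstar, happ, h0, map_zero]
        simp
      change inner ℂ (η x) (η y) = 0
      rw [← inner_conj_symm, h1, map_zero]
  have heη : ∀ x, Ψ e (η x) = η x := fun x => by
    change Ψ e (Ψ (E x₀ x) η₀) = _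
    rw [happ, heE]
  -- a vector in the range of `Ψ e` orthogonal to all `η x` spans, by heredity, the range of the
  -- image of an element of `A` annihilated by all matrix units, hence by `e`
  have hker : ∀ ζ, Ψ e ζ = ζ → (∀ x, inner ℂ (η x) ζ = 0) → ζ = 0 := by
    intro ζ hζ hperp
    obtain ⟨a, ha⟩ := hCΨ _ (hC.mul_mul_mem (hB (rankOne_mem_stableRoeAlgebra ζ ζ))
      (hΨC e) (hΨC e))
    have hθ : ∀ ω, Ψ a ω = (inner ℂ ζ (Ψ e ω) : ℂ) • ζ := fun ω => by
      rw [ha, mul_apply_eq_comp, mul_apply_eq_comp, rankOne_apply, map_smul, hζ]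
    have h1 : ∀ x, E x x₀ * a = 0 := by
      refine fun x => (map_eq_zero_iff Ψ hΨ).mp (ContinuousLinearMap.ext fun ω => ?_)
      rw [← happ, hθ, map_smul, hEη, hperp]
      simp
    have h2 : e * a = 0 := by
      refine Subtype.ext (ContinuousLinearMap.ext fun ω => ?_)
      refine partialIsometry_apply_eq_zero hξ hξ fun x => ?_
      have h3 : (inner ℂ (ξ x) ((a : L2 X HX →L[ℂ] L2 X HX) ω) : ℂ) • ξ x₀ = 0 :=
        congrArg (fun T : A => (T : L2 X HX →L[ℂ] L2 X HX) ω) (h1 x)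
      exact (smul_eq_zero.mp h3).resolve_right (hξ.ne_zero x₀)
    have h3 : Ψ e (Ψ a ζ) = 0 := by
      rw [happ, h2, map_zero]
      rfl
    rw [hθ, map_smul, hζ] at h3
    simpa using h3
  have hΨe : Ψ e = partialIsometry hη hη := by
    have h1 : Ψ e ∘L partialIsometry hη hη = partialIsometry hη hη :=
      comp_partialIsometry hη hη hη heη
    ext1 ζ
    rw [← sub_eq_zero]
    refine hker _ ?_ fun x => ?_
    · rw [map_sub, happ, hee]
      exact congrArg (Ψ e ζ - ·) (congrArg (fun T => T ζ) h1)
    · rw [inner_sub_right, inner_partialIsometry_left, ← hestar, ← hadj, heη, sub_self]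
  refine ⟨η, hη, hΨe ▸ hΨB e, ?_, ?_⟩
  · intro p q hp hq r hr
    let t : A := ⟨partialIsometry (hξ.comp p hp) (hξ.comp q hq), hA <|
      partialIsometry_single_mem_stableRoeAlgebra (hξ.comp p hp) (hξ.comp q hq) hp hr
        (K := Submodule.span ℂ {v}) inferInstance (fun _ => Submodule.mem_span_singleton_self v)
        fun _ => Submodule.mem_span_singleton_self v⟩
    suffices h : Ψ t = partialIsometry (hη.comp p hp) (hη.comp q hq) from h ▸ hΨB t
    have hte : t * e = t :=
      Subtype.ext (partialIsometry_comp_partialIsometry_self hξ hp (hξ.comp q hq))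
    rw [← hte, map_mul, hΨe, ← partialIsometry_comp_partialIsometry_self hη hp (hη.comp q hq)]
    refine comp_partialIsometry_congr hη hη fun x => ?_
    by_cases hx : ∃ i, p i = x
    · obtain ⟨i, rfl⟩ := hx
      have h1 : t * E x₀ (p i) = E x₀ (q i) := by
        refine Subtype.ext (ContinuousLinearMap.ext fun ζ => ?_)
        have := partialIsometry_apply_self (hξ.comp p hp) (hξ.comp q hq) i
        simp only [Function.comp_apply] at this
        simp [E, t, this]
      have h2 := partialIsometry_apply_self (hη.comp p hp) (hη.comp q hq) i
      simp only [Function.comp_apply] at h2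
      rw [h2]
      change Ψ t (Ψ (E x₀ (p i)) η₀) = _
      rw [happ, h1]
    · push Not at hx
      have h1 : t * E x₀ x = 0 := by
        refine Subtype.ext (ContinuousLinearMap.ext fun ζ => ?_)
        have := partialIsometry_apply_eq_zero (hξ.comp p hp) (hξ.comp q hq) (ζ := ξ x)
          fun i => hξ.inner_eq_zero (hx i)
        simp [E, t, this]
      rw [partialIsometry_apply_eq_zero (hη.comp p hp) (hη.comp q hq) (ζ := η x)
        fun i => hη.inner_eq_zero (hx i)]
      change Ψ t (Ψ (E x₀ x) η₀) = _
      rw [happ, h1, map_zero]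
      rfl
  · intro b hb
    obtain ⟨a, ha⟩ := hCΨ _ (hC.mul_mul_mem hb (hΨC e) (hΨC e))
    refine ⟨a, a.2, fun x x' => ?_⟩
    have h1 : Ψ (E x' x₀ * a * E x₀ x) η₀ = (inner ℂ (η x') (b (η x)) : ℂ) • η₀ := by
      rw [map_mul, map_mul, ha]
      simp only [mul_apply_eq_comp]
      change Ψ (E x' x₀) (Ψ e (b (Ψ e (η x)))) = _
      rw [heη, hEη, ← hestar, ← hadj, heη]
      exact congrArg (_ • ·) hfix
    rw [hEaE, map_smul, smul_apply, hfix] at h1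
    have hne : η₀ ≠ 0 := by
      rintro rfl
      simp at hη₀
    simpa [ξ] using smul_left_injective ℂ hne h1

end Transport

/-! ### Restriction to subspaces -/

section Compression

variable {Y H : Type*} [NormedAddCommGroup H] [InnerProductSpace ℂ H] [CompleteSpace H]

omit [CompleteSpace H] in
theorem L2.orthogonalFamily_single (S : Set Y) :
    OrthogonalFamily ℂ (fun _ : S => H) fun s : S =>
      (⟨(L2.single (s : Y)).toLinearMap, L2.norm_single (s : Y)⟩ : H →ₗᵢ[ℂ] L2 Y H) := by
  intro s t hst v w
  simp [L2.eval_single_of_ne (Subtype.val_injective.ne hst.symm)]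

/-- The isometric inclusion `ℓ₂(S, H) → ℓ₂(Y, H)`, extending functions by zero. -/
def L2.extend (S : Set Y) : L2 S H →ₗᵢ[ℂ] L2 Y H :=
  (L2.orthogonalFamily_single S).linearIsometry.comp (L2.toLp S H).toLinearIsometry

@[simp]
theorem L2.extend_single {S : Set Y} (s : S) (v : H) :
    L2.extend S (L2.single s v) = L2.single (s : Y) v :=
  letI : DecidableEq S := fun s t => Classical.propDecidable (s = t)
  (L2.orthogonalFamily_single S).linearIsometry_apply_single v

/-- The restriction map `ℓ₂(Y, H) → ℓ₂(S, H)`, defined as the adjoint of the extension by zero. -/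
def L2.restrict (S : Set Y) : L2 Y H →L[ℂ] L2 S H :=
  ContinuousLinearMap.adjoint (L2.extend S).toContinuousLinearMap

theorem L2.inner_restrict {S : Set Y} (f : L2 S H) (g : L2 Y H) :
    inner ℂ f (L2.restrict S g) = inner ℂ (L2.extend S f) g :=
  ContinuousLinearMap.adjoint_inner_right _ _ _

theorem L2.restrict_extend {S : Set Y} (f : L2 S H) : L2.restrict S (L2.extend S f) = f := by
  refine ext_inner_left ℂ fun g => ?_
  rw [L2.inner_restrict, LinearIsometry.inner_map_map]

theorem L2.extend_restrict {S : Set Y} {f : L2 Y H} (hf : ∀ y ∉ S, L2.eval y f = 0) :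
    L2.extend S (L2.restrict S f) = f := by
  have h := (L2.hasSum_single f).mapL
    ((L2.extend S).toContinuousLinearMap.comp (L2.restrict S))
  refine h.unique ?_
  convert L2.hasSum_single f using 2 with y
  by_cases hy : y ∈ S
  · have h1 := L2.restrict_extend (L2.single (⟨y, hy⟩ : S) (L2.eval y f))
    rw [L2.extend_single] at h1
    simp [h1]
  · simp [hf y hy]

/-- The compression of an operator on `ℓ₂(Y, H)` to `ℓ₂(S, H)`. -/
def compress (S : Set Y) (a : L2 Y H →L[ℂ] L2 Y H) : L2 S H →L[ℂ] L2 S H :=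
  (L2.restrict S).comp (a.comp (L2.extend S).toContinuousLinearMap)

theorem entry_compress (S : Set Y) (a : L2 Y H →L[ℂ] L2 Y H) (s t : S) :
    entry (compress S a) s t = entry a s t := by
  ext v
  refine ext_inner_left ℂ fun w => ?_
  rw [entry_apply, entry_apply, ← L2.inner_single_left, ← L2.inner_single_left]
  simp only [compress, ContinuousLinearMap.comp_apply, LinearIsometry.coe_toContinuousLinearMap]
  rw [L2.inner_restrict, L2.extend_single, L2.extend_single]

theorem compress_mem_roeAlgebra [MetricSpace Y] (S : Set Y) {a : L2 Y H →L[ℂ] L2 Y H}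
    (ha : a ∈ roeAlgebra Y H) : compress S a ∈ roeAlgebra S H := by
  have hc : Continuous (compress (H := H) S) := by
    unfold compress
    fun_prop
  refine map_mem_closure hc ha ?_
  rintro t ⟨⟨r, hr⟩, ht⟩
  refine ⟨⟨r, fun x y hxy => hr x y ?_⟩, fun x y => ?_⟩
  · rwa [entry_compress] at hxy
  · rw [entry_compress]
    exact ht x y

theorem compress_partialIsometry {ι : Type*} {S : Set Y} {β : ι → L2 S H} {α : ι → L2 Y H}
    (hα : Orthonormal ℂ α) (hβ : Orthonormal ℂ β) (h : ∀ i, L2.extend S (β i) = α i) :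
    compress S (partialIsometry hα hα) = partialIsometry hβ hβ := by
  ext1 ζ
  have h1 := (hasSum_partialIsometry hα hα (L2.extend S ζ)).mapL (L2.restrict S)
  simp only [← h, map_smul, L2.restrict_extend, LinearIsometry.inner_map_map] at h1
  exact h1.unique (hasSum_partialIsometry hβ hβ ζ)

end Compression

/-! ### Ghost projections on sparse subspaces -/

section Ghost

variable {X Y H : Type*} [NormedAddCommGroup H] [InnerProductSpace ℂ H]

variable [MetricSpace Y]

/-- If some vectors `η x` have arbitrarily small coordinates, then there is a sequence of them
which are almost supported on finite sets drifting apart from each other. -/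
theorem exists_almost_supported_sequence (hY : UniformlyLocallyFinite Y) {η : X → L2 Y H}
    (h : ∀ δ : ℝ, 0 < δ → ∃ x, ∀ y, ‖L2.eval y (η x)‖ < δ) :
    ∃ (x : ℕ → X) (S : ℕ → Finset Y), (∀ n y, ‖L2.eval y (η (x n))‖ ≤ (1 / 2) ^ n) ∧
      (∀ n, ‖η (x n) - ∑ y ∈ S n, L2.single y (L2.eval y (η (x n)))‖ ≤ 1 / 4 * (1 / 2) ^ n) ∧
      ∀ m n, m < n → ∀ y ∈ S m, ∀ z ∈ S n, (n : ℝ) < dist y z := by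
  classical
  let P : X × Finset Y × ℕ → Prop := fun a => (∀ y, ‖L2.eval y (η a.1)‖ ≤ (1 / 2) ^ a.2.2) ∧
    ‖η a.1 - ∑ y ∈ a.2.1, L2.single y (L2.eval y (η a.1))‖ ≤ 1 / 4 * (1 / 2) ^ a.2.2
  let r : X × Finset Y × ℕ → X × Finset Y × ℕ → Prop := fun a b =>
    a.2.2 < b.2.2 ∧ ∀ y ∈ a.2.1, ∀ z ∈ b.2.1, (b.2.2 : ℝ) < dist y z
  have step : ∀ s : Finset (X × Finset Y × ℕ), (∀ a ∈ s, P a) → ∃ b, P b ∧ ∀ a ∈ s, r a b := by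
    intro s _
    obtain ⟨n, hn⟩ : ∃ n, n = s.sup (fun a => a.2.2) + 1 := ⟨_, rfl⟩
    -- the finite set to be avoided by the next support
    have hfin : (⋃ a ∈ s, ⋃ y ∈ a.2.1, {z | dist y z ≤ n}).Finite :=
      s.finite_toSet.biUnion fun a _ => a.2.1.finite_toSet.biUnion fun y _ =>
        hY.finite_closedBall y n
    set G := hfin.toFinset with hG
    have hε : (0 : ℝ) < 1 / 8 * (1 / 2) ^ n := by positivity
    have hcard : (0 : ℝ) < G.card + 1 := Nat.cast_add_one_pos _
    obtain ⟨x, hx⟩ := h (min ((1 / 2) ^ n) (1 / 8 * (1 / 2) ^ n / (G.card + 1)))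
      (lt_min (pow_pos (by norm_num) n) (div_pos hε hcard))
    have hsum := L2.hasSum_single (η x)
    rw [HasSum, SummationFilter.unconditional_filter, Metric.tendsto_atTop] at hsum
    obtain ⟨F, hF⟩ := hsum _ hε
    refine ⟨(x, F \ G, n), ⟨fun y => ((hx y).trans_le (min_le_left _ _)).le, ?_⟩,
      fun a ha => ⟨?_, fun y hy z hz => ?_⟩⟩
    · have h1 := hF F le_rfl
      rw [dist_comm, dist_eq_norm] at h1
      have h2 : ‖∑ y ∈ F ∩ G, L2.single y (L2.eval y (η x))‖ ≤ 1 / 8 * (1 / 2) ^ n := by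
        calc ‖∑ y ∈ F ∩ G, L2.single y (L2.eval y (η x))‖
            ≤ ∑ y ∈ F ∩ G, (1 / 8 * (1 / 2) ^ n / (G.card + 1) : ℝ) := by
              refine norm_sum_le_of_le _ fun y _ => ?_
              rw [L2.norm_single]
              exact ((hx y).trans_le (min_le_right _ _)).le
          _ ≤ G.card * (1 / 8 * (1 / 2) ^ n / (G.card + 1) : ℝ) := by
              rw [Finset.sum_const, nsmul_eq_mul]
              gcongr
              exact Finset.inter_subset_right
          _ ≤ 1 / 8 * (1 / 2) ^ n := by
              rw [mul_div_assoc', div_le_iff₀ hcard]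
              linarith [hε]
      have h3 : η x - ∑ y ∈ F \ G, L2.single y (L2.eval y (η x)) =
          (η x - ∑ y ∈ F, L2.single y (L2.eval y (η x))) +
            ∑ y ∈ F ∩ G, L2.single y (L2.eval y (η x)) := by
        rw [← Finset.sum_inter_add_sum_sdiff F G]
        abel
      dsimp only
      rw [h3]
      refine (norm_add_le _ _).trans ?_
      linarith
    · rw [hn]
      exact Nat.lt_succ_of_le (Finset.le_sup (f := fun a : X × Finset Y × ℕ => a.2.2) ha)
    · by_contra hyz
      refine (Finset.mem_sdiff.mp hz).2 ?_
      rw [hG, Set.Finite.mem_toFinset]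
      simp only [Set.mem_iUnion]
      exact ⟨a, ha, y, hy, not_lt.mp hyz⟩
  obtain ⟨f, hP, hr⟩ := exists_seq_of_forall_finset_exists P r step
  have hmono : StrictMono fun n => (f n).2.2 := fun m n hmn => (hr m n hmn).1
  have hpow : ∀ n, (1 / 2 : ℝ) ^ (f n).2.2 ≤ (1 / 2) ^ n := fun n =>
    pow_le_pow_of_le_one (by norm_num) (by norm_num) (hmono.le_apply (x := n))
  refine ⟨fun n => (f n).1, fun n => (f n).2.1, fun n y => ((hP n).1 y).trans (hpow n),
    fun n => (hP n).2.trans (mul_le_mul_of_nonneg_left (hpow n) (by norm_num)),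
    fun m n hmn y hy z hz => ?_⟩
  refine lt_of_le_of_lt ?_ ((hr m n hmn).2 y hy z hz)
  exact_mod_cast hmono.le_apply (x := n)
/-- Finite sets drifting apart form a sparse subspace. -/
theorem isSparse_iUnion {S : ℕ → Finset Y}
    (hS : ∀ m n, m < n → ∀ y ∈ S m, ∀ z ∈ S n, (n : ℝ) < dist y z) :
    IsSparse (⋃ n, (S n : Set Y) : Set Y) := by
  have hS' : ∀ m n, m ≠ n → ∀ y ∈ S m, ∀ z ∈ S n, (max m n : ℕ) < dist y z := by
    intro m n hmn y hy z hz
    obtain h | h := hmn.lt_or_gt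
    · rw [max_eq_right h.le]; exact hS m n h y hy z hz
    · rw [max_eq_left h.le, dist_comm]; exact hS n m h z hz y hy
  refine ⟨fun n => {s | (s : Y) ∈ S n}, ?_, fun m n hmn => ?_, fun n => ?_, fun r => ?_⟩
  · ext s
    obtain ⟨n, hn⟩ := Set.mem_iUnion.mp s.2
    simpa using ⟨n, hn⟩
  · refine Set.disjoint_left.mpr fun s hm hn => ?_
    have := hS' m n hmn s hm s hn
    rw [dist_self] at this
    exact absurd this (not_lt.mpr (Nat.cast_nonneg _))
  · exact (S n).finite_toSet.preimage Subtype.val_injective.injOn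
  · obtain ⟨N, hN⟩ := exists_nat_ge r
    refine ⟨2 * N, fun n m hnm hle x hx y hy => hN.trans ?_⟩
    refine le_trans ?_ (hS' n m hnm x hx y hy).le
    exact_mod_cast (by omega : N ≤ max n m)

theorem eq_of_mem_of_mem {S : ℕ → Finset Y}
    (hS : ∀ m n, m < n → ∀ y ∈ S m, ∀ z ∈ S n, (n : ℝ) < dist y z) {m n : ℕ} {y : Y}
    (hm : y ∈ S m) (hn : y ∈ S n) : m = n := by
  have key : ∀ m n, y ∈ S m → y ∈ S n → ¬ m < n := fun m n hm hn h => by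
    have := hS m n h y hm y hn
    rw [dist_self] at this
    exact absurd this (not_lt.mpr (Nat.cast_nonneg _))
  exact le_antisymm (not_lt.mp (key n m hn hm)) (not_lt.mp (key m n hm hn))

variable [CompleteSpace H]

/-- A sequence of unit vectors with finite supports drifting apart from each other and with
coordinates tending to zero spans a ghost projection on a sparse subspace; this projection is not
compact, so it cannot lie in the Roe algebra. -/
theorem SparseSubspacesYieldCompactGhosts.partialIsometry_notMem
    (hghost : SparseSubspacesYieldCompactGhosts Y H) {S : ℕ → Finset Y}
    (hS : ∀ m n, m < n → ∀ y ∈ S m, ∀ z ∈ S n, (n : ℝ) < dist y z) {α : ℕ → L2 Y H}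
    (hα : Orthonormal ℂ α) (hsupp : ∀ n, ∀ y ∉ S n, L2.eval y (α n) = 0)
    (hsmall : ∀ n y, ‖L2.eval y (α n)‖ ≤ 2 * (1 / 2) ^ n) :
    partialIsometry hα hα ∉ roeAlgebra Y H := by
  intro hmem
  set T : Set Y := ⋃ n, (S n : Set Y) with hT
  have hext : ∀ n, L2.extend T (L2.restrict T (α n)) = α n := fun n =>
    L2.extend_restrict fun y hy => hsupp n y fun h => hy (Set.mem_iUnion.mpr ⟨n, h⟩)
  have hβ : Orthonormal ℂ fun n => L2.restrict T (α n) := by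
    rw [← (L2.extend T).orthonormal_comp_iff]
    convert hα using 1
    exact funext hext
  have hp : partialIsometry hβ hβ ∈ roeAlgebra T H := by
    rw [← compress_partialIsometry hα hβ hext]
    exact compress_mem_roeAlgebra T hmem
  have hgh : IsGhost (partialIsometry hβ hβ) := by
    intro ε hε
    obtain ⟨N, hN⟩ := exists_pow_lt_of_lt_one (half_pos hε) (by norm_num : (1 / 2 : ℝ) < 1)
    have hfin : {s : T | ∃ n < N, (s : Y) ∈ S n}.Finite := by
      have : (⋃ n ∈ Finset.range N, (S n : Set Y)).Finite :=
        (Finset.range N).finite_toSet.biUnion fun n _ => (S n).finite_toSet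
      refine (this.preimage (f := ((↑) : T → Y)) Subtype.val_injective.injOn).subset ?_
      rintro s ⟨n, hn, hs⟩
      simp only [Set.mem_preimage, Set.mem_iUnion]
      exact ⟨n, Finset.mem_range.mpr hn, hs⟩
    refine ⟨hfin.toFinset, fun s t hs _ => ?_⟩
    obtain ⟨n, hn⟩ := Set.mem_iUnion.mp s.2
    have hNn : N ≤ n := by
      by_contra h
      exact hs (hfin.mem_toFinset.mpr ⟨n, not_le.mp h, hn⟩)
    have hentry : ∀ v, entry (partialIsometry hα hα) s t v =
        (inner ℂ (L2.eval (s : Y) (α n)) v : ℂ) • L2.eval (t : Y) (α n) := by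
      intro v
      refine (hasSum_entry_partialIsometry hα hα _ _ v).unique (hasSum_single n fun m hm => ?_)
      rw [hsupp m s fun h => hm (eq_of_mem_of_mem hS h hn)]
      simp
    rw [← compress_partialIsometry hα hβ hext, entry_compress]
    refine lt_of_le_of_lt (ContinuousLinearMap.opNorm_le_bound _ (by positivity :
      (0 : ℝ) ≤ 2 * (1 / 2) ^ N) fun v => ?_) (by linarith)
    rw [hentry, norm_smul]
    have h1 : ‖L2.eval (t : Y) (α n)‖ ≤ 1 := by
      rw [← hα.norm_eq_one n]
      exact L2.norm_eval_le _ _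
    have h2 : ‖L2.eval (s : Y) (α n)‖ ≤ 2 * (1 / 2) ^ N :=
      (hsmall n s).trans (mul_le_mul_of_nonneg_left
        (pow_le_pow_of_le_one (by norm_num) (by norm_num) hNn) (by norm_num))
    calc _ ≤ (‖L2.eval (s : Y) (α n)‖ * ‖v‖) * 1 := by
          gcongr
          exact norm_inner_le_norm _ _
      _ ≤ 2 * (1 / 2) ^ N * ‖v‖ := by
          rw [mul_one]
          gcongr
  have hcpt := hghost T (isSparse_iUnion hS) _ hp (isStarProjection_partialIsometry hβ) hgh
  have hfin := finite_setOf_le_norm_of_isCompactOperator hcpt hβ one_pos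
  have huniv : {n | 1 ≤ ‖partialIsometry hβ hβ (L2.restrict T (α n))‖} = Set.univ := by
    ext n
    rw [Set.mem_ofPred_eq, partialIsometry_apply_self hβ hβ n, hβ.norm_eq_one n]
    simp
  rw [huniv] at hfin
  exact Set.infinite_univ hfin

/-- Normalizing an approximation of a unit vector at most doubles the error. -/
theorem norm_inv_norm_smul_sub_le {E : Type*} [NormedAddCommGroup E] [NormedSpace ℂ E] {e z : E}
    (he : ‖e‖ = 1) (hz : z ≠ 0) : ‖(‖z‖⁻¹ : ℂ) • z - e‖ ≤ 2 * ‖e - z‖ := by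
  have h0 : ‖z‖ ≠ 0 := norm_ne_zero_iff.mpr hz
  have h1 : ‖(‖z‖⁻¹ : ℂ) • z - z‖ ≤ ‖e - z‖ := by
    have : (‖z‖⁻¹ : ℂ) • z - z = (((‖z‖⁻¹ - 1 : ℝ)) : ℂ) • z := by
      push_cast
      rw [sub_smul, one_smul]
    rw [this, norm_smul, Complex.norm_real, Real.norm_eq_abs, ← abs_norm z, ← abs_mul, abs_norm,
      sub_mul, inv_mul_cancel₀ h0, one_mul, ← he]
    exact abs_norm_sub_norm_le _ _
  have h2 : (‖z‖⁻¹ : ℂ) • z - e = ((‖z‖⁻¹ : ℂ) • z - z) - (e - z) := by abel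
  rw [h2]
  refine (norm_sub_le _ _).trans ?_
  linarith

/-- The absence of noncompact ghost projections forces the vectors of an orthonormal family
whose subfamilies span projections in the Roe algebra to have a large coordinate each. -/
theorem SparseSubspacesYieldCompactGhosts.exists_le_norm_eval
    (hghost : SparseSubspacesYieldCompactGhosts Y H) (hY : UniformlyLocallyFinite Y)
    {B : NonUnitalStarSubalgebra ℂ (L2 Y H →L[ℂ] L2 Y H)} (hB : IsRoeLike B) {η : X → L2 Y H}
    (hη : Orthonormal ℂ η)
    (hηB : ∀ (p : ℕ → X) (hp : Function.Injective p),
      partialIsometry (hη.comp p hp) (hη.comp p hp) ∈ B) :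
    ∃ δ : ℝ, 0 < δ ∧ ∀ x, ∃ y, δ ≤ ‖L2.eval y (η x)‖ := by
  classical
  by_contra! hcon
  obtain ⟨x, S, hsmall, happrox, hS⟩ := exists_almost_supported_sequence hY hcon
  set ζ : ℕ → L2 Y H := fun n => ∑ y ∈ S n, L2.single y (L2.eval y (η (x n))) with hζ
  have hpow : ∀ n : ℕ, (1 / 2 : ℝ) ^ n ≤ 1 := fun n => pow_le_one₀ (by norm_num) (by norm_num)
  have hζnorm : ∀ n, 3 / 4 ≤ ‖ζ n‖ := by
    intro n
    have h1 := norm_sub_norm_le (η (x n)) (η (x n) - ζ n)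
    rw [sub_sub_cancel, hη.norm_eq_one] at h1
    linarith [happrox n, hpow n]
  have hζ0 : ∀ n, ζ n ≠ 0 := fun n h => by
    have := hζnorm n
    rw [h, norm_zero] at this
    linarith
  -- normalized truncations
  set α : ℕ → L2 Y H := fun n => (‖ζ n‖⁻¹ : ℂ) • ζ n with hαdef
  have heval : ∀ n y, L2.eval y (α n) =
      (‖ζ n‖⁻¹ : ℂ) • if y ∈ S n then L2.eval y (η (x n)) else 0 := by
    intro n y
    rw [hαdef, map_smul, hζ, L2.eval_sum_single]
  have hsupp : ∀ n, ∀ y ∉ S n, L2.eval y (α n) = 0 := by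
    intro n y hy
    rw [heval, if_neg hy, smul_zero]
  have hαsmall : ∀ n y, ‖L2.eval y (α n)‖ ≤ 2 * (1 / 2) ^ n := by
    intro n y
    have h1 : ‖ζ n‖⁻¹ ≤ 2 := by
      rw [inv_le_comm₀ (by linarith [hζnorm n]) two_pos]
      linarith [hζnorm n]
    rw [heval, norm_smul]
    have h2 : ‖(‖ζ n‖⁻¹ : ℂ)‖ ≤ 2 := by simpa using h1
    gcongr
    split_ifs
    · exact hsmall n y
    · rw [norm_zero]; positivity
  have hα : Orthonormal ℂ α := by
    refine ⟨fun n => ?_, fun m n hmn => ?_⟩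
    · rw [hαdef, norm_smul]
      simp [hζ0 n]
    · have h := (L2.hasSum_single (α n)).mapL (innerSL ℂ (α m))
      refine h.unique ?_
      convert hasSum_zero using 2 with y
      simp only [innerSL_apply_apply, L2.inner_single_right]
      by_cases hm : y ∈ S m
      · have hn : y ∉ S n := fun hn => hmn (eq_of_mem_of_mem hS hm hn)
        rw [hsupp n y hn, inner_zero_right]
      · rw [hsupp m y hm, inner_zero_left]
  have hclose : ∀ n, ‖α n - η (x n)‖ ≤ 1 / 2 * (1 / 2) ^ n := by
    intro n
    refine (norm_inv_norm_smul_sub_le (hη.norm_eq_one _) (hζ0 n)).trans ?_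
    linarith [happrox n]
  have hxinj : Function.Injective x := by
    refine Function.Injective.of_lt_imp_ne fun m n hmn heq => ?_
    have h1 : ‖α m - α n‖ ≤ 3 / 4 := by
      have h2 : α m - α n = (α m - η (x m)) - (α n - η (x n)) := by rw [heq]; abel
      rw [h2]
      refine (norm_sub_le _ _).trans ?_
      have h3 : (1 / 2 : ℝ) ^ n ≤ 1 / 2 := by
        simpa using pow_le_pow_of_le_one (by norm_num : (0 : ℝ) ≤ 1 / 2) (by norm_num)
          (Nat.one_le_iff_ne_zero.mpr (Nat.ne_zero_of_lt hmn))
      linarith [hclose m, hclose n, hpow m]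
    have h2 : ‖α m - α n‖ ^ 2 = 2 := by
      have := norm_sub_sq (𝕜 := ℂ) (α m) (α n)
      rw [hα.inner_eq_zero hmn.ne, hα.norm_eq_one, hα.norm_eq_one] at this
      rw [this]; norm_num
    nlinarith [norm_nonneg (α m - α n)]
  -- the projection onto the span of the truncations is a compact perturbation of that onto the
  -- span of the vectors `η (x n)`
  have hdiff := hasSum_rankOne_sub_rankOne hα (hη.comp x hxinj) <|
    Summable.of_nonneg_of_le (fun _ => norm_nonneg _) hclose (summable_geometric_two.mul_left _)
  have hmemdiff : partialIsometry hα hα -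
      partialIsometry (hη.comp x hxinj) (hη.comp x hxinj) ∈ B := by
    rw [HasSum, SummationFilter.unconditional_filter] at hdiff
    exact hB.isClosed.mem_of_tendsto hdiff (Eventually.of_forall fun s => sum_mem fun n _ =>
      sub_mem (hB.stable_subset (rankOne_mem_stableRoeAlgebra _ _))
        (hB.stable_subset (rankOne_mem_stableRoeAlgebra _ _)))
  have hmem : partialIsometry hα hα ∈ B := by
    simpa using add_mem hmemdiff (hηB x hxinj)
  exact hghost.partialIsometry_notMem hS hα hsupp hαsmall (hB.subset_roe hmem)

end Ghost

/-! ### Sequences of pairs with small interference -/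

/-- Let `D` be unbounded on a relation `Q` with finite fibres, and let `m` vanish at infinity in
each variable. Then there are pairs in `Q` along which `D` tends to infinity and whose mutual
interference, as measured by `m`, is summably small. -/
theorem exists_pairs_of_small_interference {X : Type*} {Q : X → X → Prop} {D m : X → X → ℝ}
    (hQ : ∀ x, {x' | Q x x'}.Finite) (hQ' : ∀ x', {x | Q x x'}.Finite)
    (hm : ∀ x ε, 0 < ε → {z | ε ≤ m x z}.Finite) (hm' : ∀ z ε, 0 < ε → {x | ε ≤ m x z}.Finite)
    (hD : ∀ R, ∃ x x', Q x x' ∧ R ≤ D x x') {ε : ℝ} (hε : 0 < ε) :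
    ∃ p q : ℕ → X, Function.Injective p ∧ Function.Injective q ∧ (∀ n, Q (p n) (q n)) ∧
      (∀ n : ℕ, n ≤ D (p n) (q n)) ∧
      (∀ k n, k ≠ n → m (p k) (p n) ≤ ε * (1 / 2) ^ max k n) ∧
      ∀ k n, k ≠ n → m (q k) (q n) ≤ ε * (1 / 2) ^ max k n := by
  let P : X × X × ℕ → Prop := fun a => Q a.1 a.2.1 ∧ a.2.2 ≤ D a.1 a.2.1
  let far : ℕ → X → X → Prop := fun j x z =>
    x ≠ z ∧ m x z ≤ ε * (1 / 2) ^ j ∧ m z x ≤ ε * (1 / 2) ^ j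
  let r : X × X × ℕ → X × X × ℕ → Prop := fun a b =>
    a.2.2 < b.2.2 ∧ far b.2.2 a.1 b.1 ∧ far b.2.2 a.2.1 b.2.1
  have hfar : ∀ j x, {z | ¬ far j x z}.Finite := by
    intro j x
    have hj : 0 < ε * (1 / 2) ^ j := mul_pos hε (pow_pos (by norm_num) j)
    refine (((Set.finite_singleton x).union (hm x _ hj)).union (hm' x _ hj)).subset ?_
    intro z hz
    by_contra h
    simp only [Set.mem_union, Set.mem_singleton_iff, Set.mem_ofPred_eq, not_or, not_le] at h
    exact hz ⟨Ne.symm h.1.1, h.1.2.le, h.2.le⟩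
  have step : ∀ s : Finset (X × X × ℕ), (∀ a ∈ s, P a) → ∃ b, P b ∧ ∀ a ∈ s, r a b := by
    intro s _
    obtain ⟨j, hj⟩ : ∃ j, j = s.sup (fun a => a.2.2) + 1 := ⟨_, rfl⟩
    have h1 : (⋃ a ∈ s, {z | ¬ far j a.1 z}).Finite :=
      s.finite_toSet.biUnion fun a _ => hfar j a.1
    have h2 : (⋃ a ∈ s, {z | ¬ far j a.2.1 z}).Finite :=
      s.finite_toSet.biUnion fun a _ => hfar j a.2.1
    -- only finitely many pairs in `Q` have a component that is not far from the previous pairs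
    set bad : Set (X × X) := (⋃ x ∈ (⋃ a ∈ s, {z | ¬ far j a.1 z}), Prod.mk x '' {x' | Q x x'}) ∪
        ⋃ x' ∈ (⋃ a ∈ s, {z | ¬ far j a.2.1 z}), (fun x => (x, x')) '' {x | Q x x'}
    have hbad : bad.Finite :=
      (h1.biUnion fun x _ => (hQ x).image _).union (h2.biUnion fun x' _ => (hQ' x').image _)
    obtain ⟨R, hR⟩ := (hbad.image fun z => D z.1 z.2).bddAbove
    obtain ⟨x, x', hxx, hDx⟩ := hD (max (R + 1) j)
    have hlt : R < D x x' := by linarith [(le_max_left (R + 1) (j : ℝ)).trans hDx]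
    have hnot : (x, x') ∉ bad := fun h => not_le.mpr hlt (hR ⟨(x, x'), h, rfl⟩)
    refine ⟨(x, x', j), ⟨hxx, (le_max_right _ _).trans hDx⟩, fun a ha => ⟨?_, ?_, ?_⟩⟩
    · rw [hj]
      exact Nat.lt_succ_of_le (Finset.le_sup (f := fun a : X × X × ℕ => a.2.2) ha)
    · by_contra h
      refine hnot (Or.inl (Set.mem_biUnion ?_ ⟨x', hxx, rfl⟩))
      exact Set.mem_biUnion (s := (s : Set (X × X × ℕ))) ha h
    · by_contra h
      refine hnot (Or.inr (Set.mem_biUnion ?_ ⟨x, hxx, rfl⟩))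
      exact Set.mem_biUnion (s := (s : Set (X × X × ℕ))) ha h
  obtain ⟨f, hP, hr⟩ := exists_seq_of_forall_finset_exists P r step
  have hmono : StrictMono fun n => (f n).2.2 := fun k n hkn => (hr k n hkn).1
  have hpow : ∀ n, ε * (1 / 2 : ℝ) ^ (f n).2.2 ≤ ε * (1 / 2) ^ n := fun n =>
    mul_le_mul_of_nonneg_left
      (pow_le_pow_of_le_one (by norm_num) (by norm_num) (hmono.le_apply (x := n))) hε.le
  refine ⟨fun n => (f n).1, fun n => (f n).2.1,
    Function.Injective.of_lt_imp_ne fun k n hkn => (hr k n hkn).2.1.1,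
    Function.Injective.of_lt_imp_ne fun k n hkn => (hr k n hkn).2.2.1,
    fun n => (hP n).1, fun n => le_trans ?_ (hP n).2, fun k n hkn => ?_, fun k n hkn => ?_⟩
  · exact_mod_cast hmono.le_apply (x := n)
  · obtain h | h := hkn.lt_or_gt
    · rw [max_eq_right h.le]
      exact (hr k n h).2.1.2.1.trans (hpow n)
    · rw [max_eq_left h.le]
      exact (hr n k h).2.1.2.2.trans (hpow k)
  · obtain h | h := hkn.lt_or_gt
    · rw [max_eq_right h.le]
      exact (hr k n h).2.2.2.1.trans (hpow n)
    · rw [max_eq_left h.le]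
      exact (hr n k h).2.2.2.2.trans (hpow k)

/-! ### Coordinates of the transported vectors -/

section Coordinates

variable {X Y H : Type*} [MetricSpace Y] [NormedAddCommGroup H] [InnerProductSpace ℂ H]

omit [MetricSpace Y] in
theorem L2.finite_setOf_le_norm_eval (f : L2 Y H) {ε : ℝ} (hε : 0 < ε) :
    {y | ε ≤ ‖L2.eval y f‖}.Finite := by
  have h := (L2.hasSum_single f).summable.tendsto_cofinite_zero.norm
  simp only [L2.norm_single, norm_zero] at h
  simpa [Filter.eventually_cofinite] using h.eventually_lt_const hε

variable [CompleteSpace H]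

/-- Local compactness of the Roe algebra: if the projection onto the span of an orthonormal family
belongs to the Roe algebra, then each coordinate vanishes at infinity along the family. -/
theorem finite_setOf_le_norm_eval_orthonormal (hY : UniformlyLocallyFinite Y) {η : X → L2 Y H}
    (hη : Orthonormal ℂ η) (hmem : partialIsometry hη hη ∈ roeAlgebra Y H) (y : Y) {ε : ℝ}
    (hε : 0 < ε) : {x | ε ≤ ‖L2.eval y (η x)‖}.Finite := by
  have h := finite_setOf_le_norm_of_isCompactOperator (isCompactOperator_eval_comp hY hmem y) hη hε
  simpa [partialIsometry_apply_self hη hη] using h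

/-- The coordinates of the vectors `η x` are approximated by vectors `u x` such that partial
translations with coefficients proportional to `u` belong to `B`. If `B` is the stable Roe algebra,
then the vectors `u x` are chosen in one finite-dimensional subspace, which is possible since the
projection onto the span of `η` is approximated by operators with entries in such a subspace. -/
theorem exists_approximating_vectors {B : NonUnitalStarSubalgebra ℂ (L2 Y H →L[ℂ] L2 Y H)}
    (hB : (B : Set (L2 Y H →L[ℂ] L2 Y H)) = stableRoeAlgebra Y H ∨ uniformAlgebra Y H ⊆ B)
    {η : X → L2 Y H} (hη : Orthonormal ℂ η) (hmem : partialIsometry hη hη ∈ B) (f : X → Y)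
    {δ : ℝ} (hδ : 0 < δ) :
    ∃ u : X → H, (∀ x, ‖L2.eval (f x) (η x) - u x‖ ≤ δ / 4) ∧
      ∀ w : X → H, (∀ x, ∃ c : ℂ, w x = c • u x) → ∀ (p q : ℕ → X) (r : ℝ),
        Function.Injective (f ∘ p) → (∀ n, dist (f (p n)) (f (q n)) ≤ r) →
        ∀ (hα : Orthonormal ℂ fun n => L2.single (f (p n)) (w (p n)))
          (hβ : Orthonormal ℂ fun n => L2.single (f (q n)) (w (q n))),
          partialIsometry hα hβ ∈ B := by
  obtain hB | hB := hB
  · have hmem' : partialIsometry hη hη ∈ stableRoeAlgebra Y H := hB ▸ hmem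
    obtain ⟨t, ⟨-, K, hK, hKt⟩, ht⟩ := Metric.mem_closure_iff.mp hmem' (δ / 4) (by linarith)
    have htK : ∀ g y, L2.eval y (t g) ∈ K := by
      intro g y
      have h1 := (L2.hasSum_single g).mapL ((L2.eval y).comp t)
      rw [HasSum, SummationFilter.unconditional_filter] at h1
      exact K.closed_of_finiteDimensional.mem_of_tendsto h1 (Eventually.of_forall fun s =>
        K.sum_mem fun x _ => (hKt x y).1 _)
    refine ⟨fun x => L2.eval (f x) (t (η x)), fun x => ?_, fun w hw p q r hp hr hα hβ => ?_⟩
    · calc ‖L2.eval (f x) (η x) - L2.eval (f x) (t (η x))‖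
          = ‖L2.eval (f x) ((partialIsometry hη hη - t) (η x))‖ := by
            simp [partialIsometry_apply_self hη hη]
        _ ≤ ‖(partialIsometry hη hη - t) (η x)‖ := L2.norm_eval_le _ _
        _ ≤ ‖partialIsometry hη hη - t‖ := by
            simpa [hη.norm_eq_one] using (partialIsometry hη hη - t).le_opNorm (η x)
        _ ≤ δ / 4 := by rw [← dist_eq_norm]; exact ht.le
    · have hwK : ∀ x, w x ∈ K := fun x => by
        obtain ⟨c, hc⟩ := hw x
        rw [hc]
        exact K.smul_mem _ (htK _ _)
      have := partialIsometry_single_mem_stableRoeAlgebra hα hβ hp hr hK (fun n => hwK (p n))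
        fun n => hwK (q n)
      rwa [← hB] at this
  · refine ⟨fun x => L2.eval (f x) (η x), fun x => ?_, fun w hw p q r hp hr hα hβ => ?_⟩
    · rw [sub_self, norm_zero]; positivity
    · exact hB (partialIsometry_single_mem_uniformAlgebra hα hβ hp hr)

omit [CompleteSpace H] in
theorem exists_unit_vector_of_norm_sub_le {δ : ℝ} (hδ : 0 < δ) {e u : H} (he : δ ≤ ‖e‖)
    (hu : ‖e - u‖ ≤ δ / 4) :
    ∃ w : H, ‖w‖ = 1 ∧ (∃ c : ℂ, w = c • u) ∧ δ / 2 ≤ ‖(inner ℂ w e : ℂ)‖ := by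
  have hun : 3 / 4 * δ ≤ ‖u‖ := by
    have h1 := norm_sub_norm_le e u
    linarith
  have hu0 : ‖u‖ ≠ 0 := fun h => by linarith
  have hw1 : ‖(‖u‖⁻¹ : ℂ) • u‖ = 1 := by
    rw [norm_smul, norm_inv, Complex.norm_real, norm_norm, inv_mul_cancel₀ hu0]
  refine ⟨(‖u‖⁻¹ : ℂ) • u, hw1, ⟨_, rfl⟩, ?_⟩
  have h1 : ‖(inner ℂ ((‖u‖⁻¹ : ℂ) • u) u : ℂ)‖ = ‖u‖ := by
    rw [inner_smul_left, norm_mul, RCLike.norm_conj, norm_inv, Complex.norm_real, norm_norm,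
      ← inner_self_re_eq_norm, inner_self_eq_norm_mul_norm, inv_mul_cancel_left₀ hu0]
  have h2 : ‖(inner ℂ ((‖u‖⁻¹ : ℂ) • u) (u - e) : ℂ)‖ ≤ δ / 4 := by
    refine (norm_inner_le_norm _ _).trans ?_
    rwa [hw1, one_mul, norm_sub_rev]
  rw [inner_sub_right] at h2
  have h3 := norm_sub_norm_le (inner ℂ ((‖u‖⁻¹ : ℂ) • u) u : ℂ) (inner ℂ ((‖u‖⁻¹ : ℂ) • u) e)
  linarith

/-- The large coordinates of the vectors `η x` can be detected by unit vectors `w x` such that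
partial translations with coefficients in `w` belong to `B`. -/
theorem exists_detecting_vectors {B : NonUnitalStarSubalgebra ℂ (L2 Y H →L[ℂ] L2 Y H)}
    (hB : (B : Set (L2 Y H →L[ℂ] L2 Y H)) = stableRoeAlgebra Y H ∨ uniformAlgebra Y H ⊆ B)
    {η : X → L2 Y H} (hη : Orthonormal ℂ η) (hmem : partialIsometry hη hη ∈ B) {f : X → Y}
    {δ : ℝ} (hδ : 0 < δ) (hf : ∀ x, δ ≤ ‖L2.eval (f x) (η x)‖) :
    ∃ w : X → H, (∀ x, ‖w x‖ = 1) ∧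
      (∀ x, δ / 2 ≤ ‖(inner ℂ (w x) (L2.eval (f x) (η x)) : ℂ)‖) ∧
      ∀ (p q : ℕ → X) (r : ℝ), Function.Injective (f ∘ p) → (∀ n, dist (f (p n)) (f (q n)) ≤ r) →
        ∀ (hα : Orthonormal ℂ fun n => L2.single (f (p n)) (w (p n)))
          (hβ : Orthonormal ℂ fun n => L2.single (f (q n)) (w (q n))),
          partialIsometry hα hβ ∈ B := by
  obtain ⟨u, hu, huB⟩ := exists_approximating_vectors hB hη hmem f hδ
  choose w hw hwu hwe using fun x => exists_unit_vector_of_norm_sub_le hδ (hf x) (hu x)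
  exact ⟨w, hw, hwe, huB w hwu⟩

end Coordinates

/-! ### The coarse embedding -/

section Embedding

variable {X Y HX HY : Type*} [MetricSpace X] [MetricSpace Y]
  [NormedAddCommGroup HX] [InnerProductSpace ℂ HX]
  [NormedAddCommGroup HY] [InnerProductSpace ℂ HY] [CompleteSpace HY]
  {B : NonUnitalStarSubalgebra ℂ (L2 Y HY →L[ℂ] L2 Y HY)}
  {η : X → L2 Y HY} {f : X → Y} {w : X → HY} {c : ℝ}

/-- If `f` were not coarse, then pairs `p n`, `q n` at bounded distance with
`dist (f (p n)) (f (q n)) → ∞` and small interference would give an operator in `B`, the image of a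
partial translation of `X`, whose entries at `f (p n)`, `f (q n)` are at least `c ^ 2 / 2`. -/
theorem isCoarse_of_detecting (hX : UniformlyLocallyFinite X)
    (hB : (B : Set (L2 Y HY →L[ℂ] L2 Y HY)) ⊆ roeAlgebra Y HY) (hη : Orthonormal ℂ η)
    (hηB : ∀ (p q : ℕ → X) (hp : Function.Injective p) (hq : Function.Injective q) (r : ℝ),
      (∀ i, dist (p i) (q i) ≤ r) → partialIsometry (hη.comp p hp) (hη.comp q hq) ∈ B)
    (hm : ∀ x ε, 0 < ε → {z | ε ≤ ‖L2.eval (f z) (η x)‖}.Finite)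
    (hm' : ∀ z ε, 0 < ε → {x | ε ≤ ‖L2.eval (f z) (η x)‖}.Finite)
    (hw : ∀ x, ‖w x‖ = 1) (hc : 0 < c)
    (hwc : ∀ x, c ≤ ‖(inner ℂ (w x) (L2.eval (f x) (η x)) : ℂ)‖) : IsCoarse f := by
  intro s hs
  by_contra! hcon
  have hc2 : 0 < c ^ 2 := by positivity
  obtain ⟨p, q, hp, hq, hQ, hD, hpm, -⟩ := exists_pairs_of_small_interference
    (Q := fun x x' => dist x x' ≤ s) (D := fun x x' => dist (f x) (f x'))
    (m := fun x z => ‖L2.eval (f z) (η x)‖) (fun x => hX.finite_closedBall x s)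
    (fun x => by simpa [dist_comm] using hX.finite_closedBall x s) hm hm'
    (fun R => by
      obtain ⟨x, x', h1, h2⟩ := hcon (max R 1) (by positivity)
      exact ⟨x, x', h1.le, (le_max_left _ _).trans h2⟩) (ε := c ^ 2 / 4) (by positivity)
  obtain ⟨r, hr⟩ := exists_norm_entry_lt_of_mem_roeAlgebra (hB (hηB p q hp hq s hQ))
    (half_pos hc2)
  obtain ⟨n, hn⟩ := exists_nat_gt r
  have hsmall := hr _ _ (hn.trans_le (hD n))
  have hle := norm_inner_single_le (partialIsometry (hη.comp p hp) (hη.comp q hq))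
    (f (p n)) (f (q n)) (w (p n)) (w (q n))
  rw [hw, hw, one_mul, mul_one] at hle
  have hbig := le_norm_inner_partialIsometry (hη.comp p hp) (hη.comp q hq)
    (ζ := L2.single (f (p n)) (w (p n))) (ω := L2.single (f (q n)) (w (q n)))
    (c := c ^ 2) (ε := c ^ 2 / 4) (by positivity) n ?_ ?_
  · linarith
  · rw [norm_mul, L2.inner_single_right, L2.inner_single_left, ← inner_conj_symm,
      RCLike.norm_conj, sq]
    exact mul_le_mul (hwc _) (hwc _) hc.le (norm_nonneg _)
  · intro k hk
    rw [norm_mul, L2.inner_single_right, L2.inner_single_left]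
    have h1 : ‖(inner ℂ (L2.eval (f (p n)) (η (p k))) (w (p n)) : ℂ)‖ ≤
        c ^ 2 / 4 * (1 / 2) ^ k := by
      refine (norm_inner_le_norm _ _).trans ?_
      rw [hw, mul_one]
      refine (hpm k n hk).trans (mul_le_mul_of_nonneg_left
        (pow_le_pow_of_le_one (by norm_num) (by norm_num) (le_max_left _ _)) (by positivity))
    have h2 : ‖(inner ℂ (w (q n)) (L2.eval (f (q n)) (η (q k))) : ℂ)‖ ≤ 1 := by
      refine (norm_inner_le_norm _ _).trans ?_
      rw [hw, one_mul, ← hη.norm_eq_one (q k)]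
      exact L2.norm_eval_le _ _
    exact (mul_le_mul h1 h2 (norm_nonneg _) (by positivity)).trans_eq (mul_one _)

/-- If `f` were not expanding, then pairs `p n`, `q n` with `dist (p n) (q n) → ∞`, with
`f (p n)`, `f (q n)` at bounded distance and with small interference would give a partial
translation in `B` which pulls back to an operator in the Roe algebra of `X` whose entries at
`p n`, `q n` are at least `c ^ 2 / 2`. -/
theorem isExpanding_of_detecting (hY : UniformlyLocallyFinite Y) (hη : Orthonormal ℂ η)
    (hpull : ∀ b ∈ B, ∃ a ∈ roeAlgebra X HX, ∀ x x' : X,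
      ‖(inner ℂ (η x') (b (η x)) : ℂ)‖ ≤ ‖entry a x x'‖)
    (hm : ∀ x ε, 0 < ε → {z | ε ≤ ‖L2.eval (f z) (η x)‖}.Finite)
    (hm' : ∀ z ε, 0 < ε → {x | ε ≤ ‖L2.eval (f z) (η x)‖}.Finite)
    (hfin : ∀ y, (f ⁻¹' {y}).Finite)
    (hw : ∀ x, ‖w x‖ = 1) (hc : 0 < c)
    (hwc : ∀ x, c ≤ ‖(inner ℂ (w x) (L2.eval (f x) (η x)) : ℂ)‖)
    (hwB : ∀ (p q : ℕ → X) (r : ℝ), Function.Injective (f ∘ p) →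
      (∀ n, dist (f (p n)) (f (q n)) ≤ r) →
        ∀ (hα : Orthonormal ℂ fun n => L2.single (f (p n)) (w (p n)))
          (hβ : Orthonormal ℂ fun n => L2.single (f (q n)) (w (q n))),
          partialIsometry hα hβ ∈ B) : IsExpanding f := by
  intro r hr
  by_contra! hcon
  have hc2 : 0 < c ^ 2 := by positivity
  have hball : ∀ x, {x' | dist (f x) (f x') ≤ r}.Finite := fun x =>
    (hY.finite_closedBall (f x) r).preimage' fun y _ => hfin y
  -- the first bound controls the sum of the interferences, the second one forces injectivity
  set ε := min (c ^ 2 / 4) (c / 2) with hε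
  have hε0 : 0 < ε := lt_min (by positivity) (by positivity)
  obtain ⟨p, q, hp, hq, hQ, hD, hpm, hqm⟩ := exists_pairs_of_small_interference
    (Q := fun x x' => dist (f x) (f x') ≤ r) (D := fun x x' => dist x x')
    (m := fun x z => ‖L2.eval (f z) (η x)‖) hball
    (fun x => by simpa [dist_comm] using hball x) hm hm'
    (fun R => by
      obtain ⟨x, x', h1, h2⟩ := hcon (max R 1) (by positivity)
      exact ⟨x, x', h2, (le_max_left _ _).trans h1.le⟩) hε0
  have hpow : ∀ n : ℕ, ε * (1 / 2 : ℝ) ^ n ≤ ε := fun n =>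
    mul_le_of_le_one_right hε0.le (pow_le_one₀ (by norm_num) (by norm_num))
  have heval : ∀ x, c ≤ ‖L2.eval (f x) (η x)‖ := fun x => by
    refine (hwc x).trans ((norm_inner_le_norm _ _).trans ?_)
    rw [hw, one_mul]
  -- small interference forces `f` to be injective along both sequences
  have hinj : ∀ g : ℕ → X, (∀ k n, k ≠ n →
      ‖L2.eval (f (g n)) (η (g k))‖ ≤ ε * (1 / 2) ^ max k n) → Function.Injective (f ∘ g) := by
    intro g hg k n hkn
    by_contra hne
    have h1 := (hg k n hne).trans (hpow _)
    have h2 : f (g k) = f (g n) := hkn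
    rw [← h2] at h1
    linarith [heval (g k), min_le_right (c ^ 2 / 4) (c / 2)]
  have hα := orthonormal_single (hinj p hpm) (u := fun n => w (p n)) fun n => hw _
  have hβ := orthonormal_single (hinj q hqm) (u := fun n => w (q n)) fun n => hw _
  obtain ⟨a, ha, hab⟩ := hpull _ (hwB p q r (hinj p hpm) hQ hα hβ)
  obtain ⟨R, hR⟩ := exists_norm_entry_lt_of_mem_roeAlgebra ha (half_pos hc2)
  obtain ⟨n, hn⟩ := exists_nat_gt R
  have hsmall := hR _ _ (hn.trans_le (hD n))
  have hle := hab (p n) (q n)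
  have hbig := le_norm_inner_partialIsometry hα hβ (ζ := η (p n)) (ω := η (q n))
    (c := c ^ 2) (ε := c ^ 2 / 4) (by positivity) n ?_ ?_
  · linarith
  · simp only [Function.comp_apply]
    rw [norm_mul, L2.inner_single_right, L2.inner_single_left,
      ← inner_conj_symm (L2.eval (f (q n)) (η (q n))), RCLike.norm_conj, sq]
    exact mul_le_mul (hwc _) (hwc _) hc.le (norm_nonneg _)
  · intro k hk
    simp only [Function.comp_apply]
    rw [norm_mul, L2.inner_single_right, L2.inner_single_left]
    have h1 : ‖(inner ℂ (w (p k)) (L2.eval (f (p k)) (η (p n))) : ℂ)‖ ≤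
        c ^ 2 / 4 * (1 / 2) ^ k := by
      refine (norm_inner_le_norm _ _).trans ?_
      rw [hw, one_mul]
      refine (hpm n k hk.symm).trans (mul_le_mul (min_le_left _ _)
        (pow_le_pow_of_le_one (by norm_num) (by norm_num) (le_max_right _ _)) (by positivity)
        (by positivity))
    have h2 : ‖(inner ℂ (L2.eval (f (q k)) (η (q n))) (w (q k)) : ℂ)‖ ≤ 1 := by
      refine (norm_inner_le_norm _ _).trans ?_
      rw [hw, mul_one, ← hη.norm_eq_one (q n)]
      exact L2.norm_eval_le _ _
    exact (mul_le_mul h1 h2 (norm_nonneg _) (by positivity)).trans_eq (mul_one _)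

end Embedding

end RoeRigidity

end

open RoeRigidity in
theorem mainTheorem6
    {X Y HX HY : Type*} [MetricSpace X] [MetricSpace Y]
    [NormedAddCommGroup HX] [InnerProductSpace ℂ HX] [CompleteSpace HX]
    [TopologicalSpace.SeparableSpace HX] (hHX : ¬ FiniteDimensional ℂ HX)
    [NormedAddCommGroup HY] [InnerProductSpace ℂ HY] [CompleteSpace HY]
    [TopologicalSpace.SeparableSpace HY] (hHY : ¬ FiniteDimensional ℂ HY)
    (hX : RoeRigidity.UniformlyLocallyFinite X)
    (hY : RoeRigidity.UniformlyLocallyFinite Y)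
    (hghost : RoeRigidity.SparseSubspacesYieldCompactGhosts Y HY)
    (A : NonUnitalStarSubalgebra ℂ (RoeRigidity.L2 X HX →L[ℂ] RoeRigidity.L2 X HX))
    (B : NonUnitalStarSubalgebra ℂ (RoeRigidity.L2 Y HY →L[ℂ] RoeRigidity.L2 Y HY))
    (hA : RoeRigidity.IsRoeLike A) (hB : RoeRigidity.IsRoeLike B)
    (hB' : (B : Set (RoeRigidity.L2 Y HY →L[ℂ] RoeRigidity.L2 Y HY)) =
        RoeRigidity.stableRoeAlgebra Y HY ∨
      RoeRigidity.uniformAlgebra Y HY ⊆ B)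
    (hemb : RoeRigidity.EmbedsOntoHereditary A B) :
    ∃ f : X → Y, RoeRigidity.IsCoarseEmbedding f := by
  obtain ⟨v, hv⟩ : ∃ v : HX, ‖v‖ = 1 := by
    have : Nontrivial HX := by
      by_contra h
      rw [not_nontrivial_iff_subsingleton] at h
      exact hHX inferInstance
    exact exists_norm_eq HX zero_le_one
  obtain ⟨η, hη, hmem, hηB, hpull⟩ :=
    hemb.exists_orthonormal hA.stable_subset hB.stable_subset hv
  obtain ⟨δ, hδ, hlow⟩ := hghost.exists_le_norm_eval hY hB hη fun p hp =>
    hηB p p hp hp 0 (by simp)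
  choose f hf using hlow
  obtain ⟨w, hw, hwδ, hwB⟩ := exists_detecting_vectors hB' hη hmem hδ hf
  have hrow : ∀ (y : Y) (ε : ℝ), 0 < ε → {x | ε ≤ ‖L2.eval y (η x)‖}.Finite := fun y ε hε =>
    finite_setOf_le_norm_eval_orthonormal hY hη (hB.subset_roe hmem) y hε
  have hfin : ∀ y, (f ⁻¹' {y}).Finite := fun y =>
    (hrow y δ hδ).subset fun x hx => by
      have h := hf x
      rwa [show f x = y from hx] at h
  have hm : ∀ x ε, 0 < ε → {z | ε ≤ ‖L2.eval (f z) (η x)‖}.Finite := fun x ε hε =>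
    (L2.finite_setOf_le_norm_eval (η x) hε).preimage' fun y _ => hfin y
  refine ⟨f, isCoarse_of_detecting hX hB.subset_roe hη hηB hm (fun z => hrow (f z)) hw
    (half_pos hδ) hwδ, isExpanding_of_detecting (HX := HX) hY hη (fun b hb => ?_) hm
    (fun z => hrow (f z)) hfin hw (half_pos hδ) hwδ hwB⟩
  obtain ⟨a, ha, hab⟩ := hpull b hb
  refine ⟨a, hA.subset_roe ha, fun x x' => ?_⟩
  rw [← hab]
  simpa [hv, -L2.inner_single_left] using norm_inner_single_le a x x' v v
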